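/- **Conventions.** A centred complex Gaussian of variance $v$ is $\xi+\mathbf i\eta$ with $\xi,\eta$ independent centred real Gaussians of variance $v$ each. For $N\ge 1$, a Ginibre matrix $Z_N$ is an $N\times N$ random matrix whose entries are iid centred complex Gaussians of variance $1/N$, and a GUE random matrix is a random matrix $X_N$ with the law of $\frac12(Z_N+Z_N^*)$; thus $\mathbb E[X_N(ij)\overline{X_N(kl)}]=\delta_{ik}\delta_{jl}/N$. For a random matrix $A$ whose entries have finite absolute moments of all orders, put $\tau_N[A]=\mathbb E\big[\frac1N\operatorname{Tr}A\big]$. For $n\ge 0$, $\mathsf P_2(n)$ is the set of pairings (pair partitions) of $[n]=\{1,\dots,n\}$, identified with the fixed-point-free involutions in $\mathsf S(n)$. A pairing $\pi$ is non-crossing if there are no $a<b<c<d$ with $\pi(a)=c$ and $\pi(b)=d$. For $e:[n]\to\{1,2\}$, $\mathsf P_2^{(e)}(n)$ is the set of pairings that pair only points $k$ with equal colour $e(k)$, and $\mathsf{NC}_2^{(e)}(n)$ is the set of non-crossing pairings among them. Further, $\gamma=(1\,2\,\cdots\,n)$, $c(\sigma)$ is the number of cycles of the permutation $\sigma$ (fixed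 points included), and $\operatorname{Cat}_k=\frac1{k+1}\binom{2k}{k}$. **Theorem.** (1) Let $X_N$ be a GUE random matrix for each $N\geq 1$ (on a probability space that may depend on $N$). Its entries have finite absolute moments of all orders, and for all $N,n\ge1$ $$\tau_N[X_N^n]=\sum_{\pi\in\mathsf P_2(n)}N^{c(\gamma\pi)-1-\frac n2}.$$ Moreover, for every $n\geq 0$, $$\lim_{N\to\infty}\tau_N[X_N^n]=\begin{cases}0,& n\text{ odd},\\ \operatorname{Cat}_{n/2},& n\text{ even},\end{cases}$$ that is, $X_N$ is asymptotically standard semicircular. (2) For each $N\geq 1$ let $X_N^{(1)},X_N^{(2)}$ be independent GUE random matrices on a common probability space (which may depend on $N$). Their entries have finite absolute moments of all orders. For all $N,n\ge1$ and all $e:[n]\to\{1,2\}$, $$\tau_N\big[X_N^{(e(1))}\cdots X_N^{(e(n))}\big]=\sum_{\pi\in\mathsf P_2^{(e)}(n)}N^{c(\gamma\pi)-1-\frac n2},$$ and, for all $n\ge0$ and all $e:[n]\to\{1,2\}$, $$\lim_{N\to\infty}\tau_N\big[X_N^{(e(1))}\cdots X_N^{(e(n))}\big]=\big|\mathsf{NC}_2^{(e)}(n)\big|.$$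 Consequently each $X_N^{(i)}$ is asymptotically standard semicircular in the sense of (1), and $X_N^{(1)},X_N^{(2)}$ are asymptotically free: for all $m\ge1$, all $i_1,\dots,i_m\in\{1,2\}$ with $i_j\ne i_{j+1}$ for $1\le j<m$, and all $f_1,\dots,f_m\in\mathbb C[x]$ with $\lim_{N\to\infty}\tau_N[f_j(X_N^{(i_j)})]=0$ for every $j$, one has $$\lim_{N\to\infty}\tau_N\big[f_1(X_N^{(i_1)})\cdots f_m(X_N^{(i_m)})\big]=0.$$ -/

import Mathlib

open MeasureTheory ProbabilityTheory Filter Topology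
open scoped NNReal ENNReal Matrix

noncomputable section

/-! ### Pairings, non-crossing pairings, cycles -/

/-- The pairings (pair partitions) of `Fin n`, viewed as fixed-point-free involutions. -/
def pairings (n : ℕ) : Set (Equiv.Perm (Fin n)) :=
  {π | ∀ k, π (π k) = k ∧ π k ≠ k}

/-- The pairings which only pair points of the same colour, for a colouring `e`. -/
def colouredPairings {n : ℕ} (e : Fin n → Fin 2) : Set (Equiv.Perm (Fin n)) :=
  {π | π ∈ pairings n ∧ ∀ k, e (π k) = e k}

/-- A pairing is non-crossing if there are no `a < b < c < d` with `a` paired with `c`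
and `b` paired with `d`. -/
def NonCrossing {n : ℕ} (π : Equiv.Perm (Fin n)) : Prop :=
  ¬ ∃ a b c d : Fin n, a < b ∧ b < c ∧ c < d ∧ π a = c ∧ π b = d

/-- The non-crossing pairings which only pair points of the same colour. -/
def nonCrossingColouredPairings {n : ℕ} (e : Fin n → Fin 2) : Set (Equiv.Perm (Fin n)) :=
  {π | π ∈ colouredPairings e ∧ NonCrossing π}

/-- The number of cycles of a permutation, where a fixed point counts as a cycle. -/
def numCycles {n : ℕ} (σ : Equiv.Perm (Fin n)) : ℕ :=
  Nat.card (Quotient (Equiv.Perm.SameCycle.setoid σ))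

/-- The sum of `N ^ (c(γπ) - 1 - n / 2)` over the permutations `π` in `S`, where `γ` is the
full forward cycle `k ↦ k + 1` of `Fin n`; the exponent is an exponent in `ℝ`. -/
def cycleSum (N n : ℕ) (S : Set (Equiv.Perm (Fin n))) : ℝ :=
  ∑ᶠ π ∈ S, (N : ℝ) ^ ((numCycles (finRotate n * π) : ℝ) - 1 - (n : ℝ) / 2)

/-! ### Ginibre and GUE random matrices -/

/-- Matrices carry the product σ-algebra of their entries. -/
instance instMeasurableSpaceSquareMatrix (N : ℕ) :
    MeasurableSpace (Matrix (Fin N) (Fin N) ℂ) :=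
  inferInstanceAs (MeasurableSpace (Fin N → Fin N → ℂ))

/-- The centred complex Gaussian law whose real and imaginary parts are independent
centred real Gaussians of variance `v` each. -/
def complexGaussian (v : ℝ≥0) : Measure ℂ :=
  ((gaussianReal 0 v).prod (gaussianReal 0 v)).map fun x => (x.1 : ℂ) + (x.2 : ℂ) * Complex.I

/-- The law of an `N × N` Ginibre matrix: the entries are iid centred complex Gaussians of
variance `1 / N`. -/
def ginibreLaw (N : ℕ) : Measure (Matrix (Fin N) (Fin N) ℂ) :=
  (Measure.pi fun _ : Fin N => Measure.pi fun _ : Fin N => complexGaussian (N : ℝ≥0)⁻¹).map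
    Matrix.of

/-- The law of an `N × N` GUE matrix, `(Z + Z*) / 2` for a Ginibre matrix `Z`. -/
def gueLaw (N : ℕ) : Measure (Matrix (Fin N) (Fin N) ℂ) :=
  (ginibreLaw N).map fun Z => (1 / 2 : ℂ) • (Z + Zᴴ)

/-- `X` is an `N × N` GUE random matrix. -/
def IsGUE {Ω : Type*} [MeasurableSpace Ω] {N : ℕ}
    (P : Measure Ω) (X : Ω → Matrix (Fin N) (Fin N) ℂ) : Prop :=
  HasLaw X (gueLaw N) P

/-- `X 0` and `X 1` are two independent `N × N` GUE random matrices. -/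
def IsGUEPair {Ω : Type*} [MeasurableSpace Ω] {N : ℕ}
    (P : Measure Ω) (X : Fin 2 → Ω → Matrix (Fin N) (Fin N) ℂ) : Prop :=
  (∀ i, IsGUE P (X i)) ∧ IndepFun (X 0) (X 1) P

/-! ### Random matrix space -/

/-- The entries of the random matrix `X` have finite absolute moments of all orders, so that
`X` is an element of the algebra `L^{∞-}(Ω, P) ⊗ M_N(ℂ)`. -/
def HasAllMoments {Ω : Type*} [MeasurableSpace Ω] {N : ℕ}
    (P : Measure Ω) (X : Ω → Matrix (Fin N) (Fin N) ℂ) : Prop :=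
  ∀ (i j : Fin N) (p : ℝ≥0), MemLp (fun ω => X ω i j) p P

/-- The expected normalized trace `τ_N = 𝔼 ⊗ tr_N`. -/
def expTrace {Ω : Type*} [MeasurableSpace Ω] {N : ℕ}
    (P : Measure Ω) (X : Ω → Matrix (Fin N) (Fin N) ℂ) : ℂ :=
  ∫ ω, (X ω).trace / (N : ℂ) ∂P

/-! ### Asymptotic notions of free probability -/

/-- The moments of the standard semicircular distribution. -/
def semicircularMoment (n : ℕ) : ℂ :=
  if Even n then (catalan (n / 2) : ℂ) else 0

/-- The moments of `X N` with respect to the functionals `τ N` converge to the moments of a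
standard semicircular variable. -/
def AsymptoticallySemicircular {A : ℕ → Type*} [∀ N, Ring (A N)]
    (τ : ∀ N, A N → ℂ) (X : ∀ N, A N) : Prop :=
  ∀ n : ℕ, Tendsto (fun N => τ N (X N ^ n)) atTop (𝓝 (semicircularMoment n))

/-- Asymptotic freeness of `X N 0` and `X N 1`: for every non-empty alternating word
`f₁(X_{i₁}) f₂(X_{i₂}) ⋯` (adjacent indices are distinct; the word is encoded as the list of the
pairs `(iⱼ, fⱼ)`), if the expectation of each letter tends to `0`, then so does that of the
whole word. -/
def AsymptoticallyFree {A : ℕ → Type*} [∀ N, Ring (A N)] [∀ N, Algebra ℂ (A N)]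
    (τ : ∀ N, A N → ℂ) (X : ∀ N, Fin 2 → A N) : Prop :=
  ∀ w : List (Fin 2 × Polynomial ℂ), w ≠ [] → w.IsChain (fun a b => a.1 ≠ b.1) →
    (∀ a ∈ w, Tendsto (fun N => τ N (Polynomial.aeval (X N a.1) a.2)) atTop (𝓝 0)) →
    Tendsto (fun N => τ N (w.map fun a => Polynomial.aeval (X N a.1) a.2).prod) atTop (𝓝 0)

end

/-!
The GUE genus expansion, its limit, and asymptotic freeness.

*Genus expansion.* The entries of a pair of GUE matrices are linear forms in independent centred
real Gaussians of variance `1 / N`. Integration by parts for polynomials in these variables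
(`HasGaussianMoments.integral_X_mul`) gives the Wick formula (`HasGaussianMoments.wick`), a sum over
pairings. Expanding the trace of a word over closed index paths, a colour-preserving pairing `π`
contributes `N ^ (-1 - n / 2)` for each index tuple that is constant on the cycles of `γ π`, of
which there are `N ^ c(γ π)` (`IsGUEPair.expTrace_word`).

*Limit.* Multiplying a permutation by a transposition splits or merges cycles, so it changes their
number by one. Removing the pairs of `π` one at a time shows that `c(γ π) ≤ 1 + n / 2`. For a
non-crossing `π` every step splits a cycle (`NonCrossing.numCycles_eq`), whereas a crossing makes
one step merge two cycles (`numCycles_lt_of_not_nonCrossing`). Hence only the non-crossing pairings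
survive as `N → ∞`.

*Freeness.* Scanning a word from left to right, with a stack of open points, identifies the number
of coloured non-crossing pairings with the vacuum moment of the word in the semicircular operators
`ℓ_a + ℓ_a*` on the full Fock space (`prod_fockOp_vacuum_eq_ncard`). So the limit joint distribution
of the two matrices is that of these operators in the vacuum state (`tendsto_expTrace_lift`), and
asymptotic freeness reduces to their freeness: an alternating product of centred polynomials in them
maps the vacuum to a vector without vacuum component (`alternating_prod_vacuum`). The moments of a
single operator count Dyck paths, hence are Catalan numbers (`fockOp_pow_vacuum`).

A single GUE matrix is treated as the first member of a pair, as only its law matters.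
-/

noncomputable section

/-! ### The semicircular operators on the full Fock space -/

/-- The operator `ℓ_a + ℓ_a*` on the full Fock space over `ℂ²`. A vector is given by its
coordinates in the basis `e_{a₁} ⊗ ⋯ ⊗ e_{aₖ}`, indexed by the words `a₁ ⋯ aₖ`; no summability is
imposed on the coordinates. -/
def fockOp (a : Fin 2) : Module.End ℂ (List (Fin 2) → ℂ) where
  toFun f
    | [] => f [a]
    | b :: s => f (a :: b :: s) + if a = b then f s else 0
  map_add' f g := by
    ext (_ | ⟨b, s⟩)
    · rfl
    · by_cases h : a = b <;> simp [h]
      ring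
  map_smul' c f := by
    ext (_ | ⟨b, s⟩)
    · rfl
    · by_cases h : a = b <;> simp [h]
      ring

lemma fockOp_nil (a : Fin 2) (f : List (Fin 2) → ℂ) : fockOp a f [] = f [a] := rfl

lemma fockOp_cons (a b : Fin 2) (f : List (Fin 2) → ℂ) (s : List (Fin 2)) :
    fockOp a f (b :: s) = f (a :: b :: s) + if a = b then f s else 0 := rfl

/-- The vacuum vector of the full Fock space. -/
def vacuum : List (Fin 2) → ℂ := Pi.single [] 1

/-- The operator `ℓ + ℓ*` for the unilateral shift `ℓ`, acting on all sequences. -/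
def shiftOp : Module.End ℂ (ℕ → ℂ) where
  toFun u
    | 0 => u 1
    | n + 1 => u (n + 2) + u n
  map_add' u v := by
    ext (_ | n)
    · rfl
    · simp; ring
  map_smul' c u := by
    ext (_ | n)
    · rfl
    · simp; ring

lemma shiftOp_zero (u : ℕ → ℂ) : shiftOp u 0 = u 1 := rfl

lemma shiftOp_succ (u : ℕ → ℂ) (n : ℕ) : shiftOp u (n + 1) = u (n + 2) + u n := rfl

/-- The map `u ↦ ∑ₙ uₙ e_a^{⊗ n} ⊗ v`, for `v` in the part of the Fock space that is orthogonal
to the words beginning with `a` (only the coordinates of `v` at the other words are used). -/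
def prefixTensor (a : Fin 2) (v : List (Fin 2) → ℂ) : (ℕ → ℂ) →ₗ[ℂ] (List (Fin 2) → ℂ) where
  toFun u s := u (s.takeWhile (· = a)).length * v (s.dropWhile (· = a))
  map_add' u u' := by ext s; simp [add_mul]
  map_smul' c u := by ext s; simp [mul_assoc]

lemma prefixTensor_apply (a : Fin 2) (v : List (Fin 2) → ℂ) (u : ℕ → ℂ) (s : List (Fin 2)) :
    prefixTensor a v u s = u (s.takeWhile (· = a)).length * v (s.dropWhile (· = a)) := rfl

/-- `fockOp a` acts on `e_a^{⊗ n} ⊗ v` through the leading tensor power only. -/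
lemma fockOp_prefixTensor (a : Fin 2) (v : List (Fin 2) → ℂ) (u : ℕ → ℂ) :
    fockOp a (prefixTensor a v u) = prefixTensor a v (shiftOp u) := by
  ext (_ | ⟨b, s⟩)
  · simp [fockOp_nil, prefixTensor_apply, shiftOp_zero]
  · by_cases h : a = b
    · subst h
      simp [fockOp_cons, prefixTensor_apply, shiftOp_succ]
      ring
    · simp [fockOp_cons, prefixTensor_apply, shiftOp_zero, h, Ne.symm h]

lemma aeval_fockOp_prefixTensor (a : Fin 2) (v : List (Fin 2) → ℂ) (u : ℕ → ℂ)
    (f : Polynomial ℂ) :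
    Polynomial.aeval (fockOp a) f (prefixTensor a v u) =
      prefixTensor a v (Polynomial.aeval shiftOp f u) := by
  induction f using Polynomial.induction_on' with
  | add p q hp hq => simp [hp, hq]
  | monomial n c =>
    have key : ∀ u, (fockOp a ^ n) (prefixTensor a v u) = prefixTensor a v ((shiftOp ^ n) u) := by
      induction n with
      | zero => simp
      | succ n ih =>
        intro u
        rw [pow_succ, pow_succ, Module.End.mul_apply, Module.End.mul_apply, fockOp_prefixTensor, ih]
    simp [Polynomial.aeval_monomial, key, Module.algebraMap_end_eq_smul_id]

lemma prefixTensor_single_zero (a : Fin 2) (v : List (Fin 2) → ℂ) (hv : ∀ s, v (a :: s) = 0) :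
    prefixTensor a v (Pi.single 0 1) = v := by
  ext (_ | ⟨b, s⟩)
  · simp [prefixTensor_apply]
  · by_cases h : b = a
    · subst h; simp [prefixTensor_apply, hv]
    · simp [prefixTensor_apply, h]

lemma vacuum_cons (a : Fin 2) (s : List (Fin 2)) : vacuum (a :: s) = 0 := by simp [vacuum]

lemma aeval_fockOp_eq (a : Fin 2) (f : Polynomial ℂ) (v : List (Fin 2) → ℂ)
    (hv : ∀ s, v (a :: s) = 0) :
    Polynomial.aeval (fockOp a) f v =
      prefixTensor a v (Polynomial.aeval shiftOp f (Pi.single 0 1)) := by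
  rw [← aeval_fockOp_prefixTensor, prefixTensor_single_zero a v hv]

lemma aeval_fockOp_vacuum_nil (a : Fin 2) (f : Polynomial ℂ) :
    Polynomial.aeval (fockOp a) f vacuum [] = Polynomial.aeval shiftOp f (Pi.single 0 1) 0 := by
  rw [aeval_fockOp_eq a f vacuum (vacuum_cons a)]
  simp [prefixTensor_apply, vacuum]

/-- A non-empty alternating product of centred polynomials in the operators `fockOp 0`,
`fockOp 1` maps the vacuum to a vector supported on the words that begin with the index of the
first factor: each factor `f (fockOp a)` acts by `v ↦ ∑_{n ≥ 1} uₙ e_a^{⊗ n} ⊗ v`. -/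
lemma alternating_prod_vacuum (w : List (Fin 2 × Polynomial ℂ))
    (hw : w.IsChain (fun a b => a.1 ≠ b.1))
    (h0 : ∀ a ∈ w, Polynomial.aeval (fockOp a.1) a.2 vacuum [] = 0) :
    ∀ a ∈ w.head?, ∀ s : List (Fin 2), s.head? ≠ some a.1 →
      (w.map fun a => Polynomial.aeval (fockOp a.1) a.2).prod vacuum s = 0 := by
  induction w with
  | nil => simp
  | cons a w ih =>
    intro a' ha' s hs
    obtain rfl : a = a' := by simpa using ha'
    have hv : ∀ s, (w.map fun a => Polynomial.aeval (fockOp a.1) a.2).prod vacuum (a.1 :: s) = 0 := by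
      intro s
      cases w with
      | nil => simp [vacuum_cons]
      | cons b w =>
        rw [List.isChain_cons_cons] at hw
        refine ih hw.2 (fun c hc => h0 c (List.mem_cons_of_mem _ hc)) b rfl _ ?_
        simpa using hw.1
    have h0a := h0 a List.mem_cons_self
    rw [aeval_fockOp_vacuum_nil] at h0a
    rw [List.map_cons, List.prod_cons, Module.End.mul_apply, aeval_fockOp_eq _ _ _ hv,
      prefixTensor_apply]
    have : (s.takeWhile (· = a.1)).length = 0 := by
      cases s with
      | nil => rfl
      | cons b s =>
        have : b ≠ a.1 := by simpa using hs
        simp [this]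
    rw [this, h0a, zero_mul]

/-- The `n`-th power of `shiftOp` applied to `δ₀`; its coordinates count the lattice paths that
stay non-negative, and the formula is the ballot theorem. -/
lemma shiftOp_pow_single (n k : ℕ) :
    (shiftOp ^ n) (Pi.single 0 1) k =
      if Even (n + k) then
        ((n.choose ((n + k) / 2) : ℕ) : ℂ) - ((n.choose ((n + k) / 2 + 1) : ℕ) : ℂ) else 0 := by
  induction n generalizing k with
  | zero =>
    rcases k with _ | k
    · simp
    · simp only [pow_zero, Module.End.one_apply, zero_add, ne_eq, Nat.succ_ne_zero,
        not_false_eq_true, Pi.single_eq_of_ne]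
      split_ifs with h
      · obtain ⟨j, hj⟩ := h
        rw [Nat.choose_eq_zero_of_lt (by omega), Nat.choose_eq_zero_of_lt (by omega), sub_self]
      · rfl
  | succ n ih =>
    rw [pow_succ', Module.End.mul_apply]
    rcases k with _ | k
    · rw [shiftOp_zero, ih]
      simp only [add_zero]
      split_ifs with h
      · obtain ⟨p, hp⟩ := h
        obtain ⟨q, rfl⟩ : ∃ q, p = q + 1 := ⟨p - 1, by omega⟩
        obtain rfl : n = 2 * q + 1 := by omega
        have h1 : (2 * q + 1 + 1) / 2 = q + 1 := by omega
        rw [h1, Nat.choose_succ_succ (2 * q + 1) q, Nat.choose_succ_succ (2 * q + 1) (q + 1),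
          ← Nat.choose_symm_half q]
        push_cast; ring
      · rfl
    · rw [shiftOp_succ, ih, ih]
      have e1 : Even (n + (k + 2)) ↔ Even (n + 1 + (k + 1)) := by
        rw [show n + (k + 2) = n + 1 + (k + 1) by ring]
      have e2 : Even (n + k) ↔ Even (n + 1 + (k + 1)) := by
        rw [show n + 1 + (k + 1) = n + k + 2 by ring]; simp [Nat.even_add]
      simp only [e1, e2]
      split_ifs with h
      · rw [show (n + (k + 2)) / 2 = (n + k) / 2 + 1 by omega,
          show (n + 1 + (k + 1)) / 2 = (n + k) / 2 + 1 by omega,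
          Nat.choose_succ_succ n ((n + k) / 2), Nat.choose_succ_succ n ((n + k) / 2 + 1)]
        push_cast; ring
      · simp

lemma fockOp_pow_vacuum (a : Fin 2) (n : ℕ) :
    (fockOp a ^ n) vacuum [] = semicircularMoment n := by
  have h := aeval_fockOp_vacuum_nil a (Polynomial.X ^ n)
  simp only [map_pow, Polynomial.aeval_X] at h
  rw [h, shiftOp_pow_single, semicircularMoment]
  simp only [add_zero]
  split_ifs with hn
  · obtain ⟨m, rfl⟩ := hn
    rw [show (m + m) / 2 = m by omega, ← two_mul]
    have h1 := succ_mul_catalan_eq_centralBinom m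
    have h2 := Nat.choose_succ_right_eq (2 * m) m
    rw [Nat.centralBinom] at h1
    rw [show 2 * m - m = m by omega] at h2
    have h1' : ((m : ℂ) + 1) * catalan m = ((2 * m).choose m : ℕ) := by exact_mod_cast h1
    have h2' : (((2 * m).choose (m + 1) : ℕ) : ℂ) * (m + 1) = ((2 * m).choose m : ℕ) * m := by
      exact_mod_cast h2
    have : (m : ℂ) + 1 ≠ 0 := by exact_mod_cast Nat.succ_ne_zero m
    apply mul_left_cancel₀ this
    rw [h1']
    linear_combination -h2'
  · rfl

/-! ### Counting non-crossing pairings -/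

lemma mul_swap_apply_of_fixed {α : Type*} [DecidableEq α] {π : Equiv.Perm α} {a b : α}
    (ha : π a = a) (hb : π b = b) (x : α) :
    (π * Equiv.swap a b) x = if x = a then b else if x = b then a else π x := by
  rw [Equiv.Perm.mul_apply, Equiv.swap_apply_def]
  split_ifs <;> simp_all

lemma mul_swap_apply_of_apply_eq {α : Type*} [DecidableEq α] {π : Equiv.Perm α} {a b : α}
    (hab : π a = b) (hba : π b = a) (x : α) :
    (π * Equiv.swap a b) x = if x = a then a else if x = b then b else π x := by
  rw [Equiv.Perm.mul_apply, Equiv.swap_apply_def]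
  split_ifs <;> simp_all

lemma NonCrossing.mul_swap {n : ℕ} {π : Equiv.Perm (Fin n)} (h : NonCrossing π) {a b : Fin n}
    (hab : π a = b) (hba : π b = a) : NonCrossing (π * Equiv.swap a b) := by
  rintro ⟨p, q, r, t, h1, h2, h3, h4, h5⟩
  rw [mul_swap_apply_of_apply_eq hab hba] at h4 h5
  refine h ⟨p, q, r, t, h1, h2, h3, ?_, ?_⟩ <;> grind

/-- The coloured non-crossing pairings of `s ∪ {k, …, n - 1}` (fixing all other points) in which
no two elements of `s` are paired. This is the set of ways to continue after a left-to-right scan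
of the first `k` points that has left the points of `s` open. -/
def stackPairings {n : ℕ} (e : Fin n → Fin 2) (s : List (Fin n)) (k : ℕ) :
    Set (Equiv.Perm (Fin n)) :=
  {π | (∀ x, π (π x) = x) ∧ (∀ x, π x ≠ x ↔ x ∈ s ∨ k ≤ x.val) ∧ (∀ x, e (π x) = e x) ∧
    NonCrossing π ∧ ∀ x ∈ s, π x ∉ s}

lemma ncard_stackPairings_top {n : ℕ} (e : Fin n → Fin 2) (s : List (Fin n)) :
    (stackPairings e s n).ncard = if s = [] then 1 else 0 := by
  split_ifs with h
  · subst h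
    rw [Set.ncard_eq_one]
    refine ⟨1, Set.eq_singleton_iff_unique_mem.2 ⟨?_, ?_⟩⟩
    · refine ⟨fun x => rfl, fun x => by simp, fun x => rfl, ?_, by simp⟩
      rintro ⟨a, b, c, d, h1, h2, h3, h4, h5⟩
      simp only [Equiv.Perm.one_apply] at h4
      omega
    · rintro π ⟨-, h, -⟩
      ext x : 1
      by_contra hx
      rcases (h x).1 hx with h' | h'
      · simp at h'
      · omega
  · rw [Set.ncard_eq_zero, Set.eq_empty_iff_forall_notMem]
    rintro π ⟨h1, h2, -, -, h5⟩
    obtain ⟨x, hx⟩ := List.exists_mem_of_ne_nil s h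
    have hne := (h2 x).2 (Or.inl hx)
    have hne' : π (π x) ≠ π x := by rw [h1]; exact hne.symm
    rcases (h2 (π x)).1 hne' with h' | h'
    · exact h5 x hx h'
    · omega

/-- When the point `k` is paired with an open point, it is paired with the last one: the points
opened later would have to be paired across. -/
lemma stackPairings_partner {n : ℕ} {e : Fin n → Fin 2} {s : List (Fin n)} {j k : Fin n}
    (hs : (j :: s).Pairwise (· > ·)) (hk : ∀ x ∈ j :: s, x < k) {π : Equiv.Perm (Fin n)}
    (hπ : π ∈ stackPairings e (j :: s) k) (h : π k ∈ j :: s) : π k = j := by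
  obtain ⟨h1, h2, -, h4, h5⟩ := hπ
  rcases List.mem_cons.1 h with h' | h'
  · exact h'
  · exfalso
    have hlt : π k < j := (List.pairwise_cons.1 hs).1 _ h'
    have hj := (h2 j).2 (Or.inl List.mem_cons_self)
    have hj5 := h5 j List.mem_cons_self
    have hj' : π (π j) ≠ π j := by rw [h1]; exact hj.symm
    have hkj : k.val ≤ (π j).val := ((h2 (π j)).1 hj').resolve_left hj5
    have hne : k ≠ π j := fun hh => by rw [hh, h1] at hlt; exact lt_irrefl _ hlt
    exact h4 ⟨π k, j, k, π j, hlt, hk j List.mem_cons_self, lt_of_le_of_ne hkj hne, h1 k, rfl⟩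

/-- The pairings in which the point `k` closes the last open point `j`: removing the pair leaves a
pairing in which `j` is no longer open. -/
lemma ncard_stackPairings_close {n : ℕ} (e : Fin n → Fin 2) (s : List (Fin n)) (j k : Fin n)
    (hs : (j :: s).Pairwise (· > ·)) (hk : ∀ x ∈ j :: s, x < k) :
    {π | π ∈ stackPairings e (j :: s) k ∧ π k ∈ j :: s}.ncard =
      if e k = e j then (stackPairings e s (k + 1)).ncard else 0 := by
  have hjk : j < k := hk j List.mem_cons_self
  have hjs : j ∉ s := fun h => lt_irrefl _ ((List.pairwise_cons.1 hs).1 _ h)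
  have hks : k ∉ s := fun h => lt_irrefl _ (hk _ (List.mem_cons_of_mem _ h))
  split_ifs with he
  · have hfix : ∀ σ ∈ stackPairings e s (k + 1), σ j = j ∧ σ k = k := by
      rintro σ ⟨-, h2, -⟩
      constructor <;> by_contra hne
      · rcases (h2 _).1 hne with h | h
        · exact hjs h
        · omega
      · rcases (h2 _).1 hne with h | h
        · exact hks h
        · omega
    symm
    refine Set.ncard_congr (fun σ _ => σ * Equiv.swap j k) ?_ ?_ ?_
    · intro σ hσ
      obtain ⟨hj, hk'⟩ := hfix σ hσ
      have key := mul_swap_apply_of_fixed hj hk'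
      obtain ⟨h1, h2, h3, h4, h5⟩ := hσ
      have hσj : ∀ x, σ x = j → x = j := fun x hx => by rw [← h1 x, hx, hj]
      have hσk : ∀ x, σ x = k → x = k := fun x hx => by rw [← h1 x, hx, hk']
      refine ⟨⟨fun x => ?_, fun x => ?_, fun x => ?_, ?_, fun x hx => ?_⟩, ?_⟩
      · rw [key x, key]; grind
      · rw [key]
        have := h2 x
        rw [List.mem_cons]
        by_cases hxj : x = j
        · simp [hxj, hjk.ne']
        · by_cases hxk : x = k
          · simp [hxk, hjk.ne, hjk.ne']
          · have : (k : ℕ) ≠ x := fun h => hxk (Fin.ext h.symm)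
            simp only [hxj, hxk, if_false, h2 x, false_or]
            have : (k : ℕ) + 1 ≤ x ↔ (k : ℕ) ≤ x := by omega
            rw [this]
      · rw [key]
        split_ifs with hxj hxk
        · rw [hxj, he]
        · rw [hxk, he]
        · exact h3 x
      · -- The points strictly between `j` and `k` are already closed, so the new pair crosses none.
        have mid : ∀ x, j < x → x < k → σ x = x := by
          intro x hjx hxk
          by_contra hne
          rcases (h2 x).1 hne with h | h
          · exact lt_asymm hjx ((List.pairwise_cons.1 hs).1 _ h)
          · omega
        rintro ⟨p, q, r, t, hpq, hqr, hrt, hp, hq⟩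
        rw [key] at hp hq
        refine h4 ⟨p, q, r, t, hpq, hqr, hrt, ?_, ?_⟩
        · split_ifs at hp with hpj hpk
          · subst hp hpj
            have := mid q hpq hqr
            rw [if_neg hpq.ne', if_neg hqr.ne, this] at hq
            omega
          · omega
          · exact hp
        · split_ifs at hq with hqj hqk
          · subst hq hqj
            have := mid r hqr hrt
            rw [if_neg hpq.ne, if_neg (hpq.trans hjk).ne] at hp
            have := h1 p
            rw [hp] at this
            omega
          · omega
          · exact hq
      · rw [key]
        rw [List.mem_cons] at hx ⊢
        have hkjs : ¬ (k = j ∨ k ∈ s) := by simp [hks, hjk.ne']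
        by_cases hxj : x = j
        · simpa [hxj] using hkjs
        · have hxs : x ∈ s := hx.resolve_left hxj
          have hxk : x ≠ k := fun h => hks (h ▸ hxs)
          rw [if_neg hxj, if_neg hxk]
          rintro (h | h)
          · exact hxj (hσj x h)
          · exact h5 x hxs h
      · show (σ * Equiv.swap j k) k ∈ j :: s
        rw [key]; simp [hjk.ne']
    · intro σ τ _ _ h
      exact mul_right_cancel h
    · rintro π ⟨hπ, hπk⟩
      have hkj := stackPairings_partner hs hk hπ hπk
      obtain ⟨h1, h2, h3, h4, h5⟩ := hπ
      have hjk' : π j = k := by rw [← hkj, h1]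
      have key := mul_swap_apply_of_apply_eq hjk' hkj
      have hσj : ∀ x, π x = j → x = k := fun x hx => by rw [← h1 x, hx, hjk']
      have hσk : ∀ x, π x = k → x = j := fun x hx => by rw [← h1 x, hx, hkj]
      refine ⟨π * Equiv.swap j k, ⟨fun x => ?_, fun x => ?_, fun x => ?_,
        h4.mul_swap hjk' hkj, fun x hx => ?_⟩, ?_⟩
      · rw [key x, key]; grind
      · rw [key]
        by_cases hxj : x = j
        · subst hxj; simp [hjs]; omega
        · by_cases hxk : x = k
          · subst hxk; simp [hks, hxj]
          · have h7 : (k : ℕ) ≠ x := fun h => hxk (Fin.ext h.symm)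
            have h8 : (k : ℕ) + 1 ≤ x ↔ (k : ℕ) ≤ x := by omega
            rw [if_neg hxj, if_neg hxk, h2 x, h8, List.mem_cons]
            simp [hxj]
      · rw [key]
        split_ifs with hxj hxk
        · rw [hxj]
        · rw [hxk]
        · exact h3 x
      · rw [key]
        have hxj : x ≠ j := fun h => hjs (h ▸ hx)
        have hxk : x ≠ k := fun h => hks (h ▸ hx)
        rw [if_neg hxj, if_neg hxk]
        exact fun h => h5 x (List.mem_cons_of_mem _ hx) (List.mem_cons_of_mem _ h)
      · rw [mul_assoc, Equiv.swap_mul_self, mul_one]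
  · rw [Set.ncard_eq_zero, Set.eq_empty_iff_forall_notMem]
    rintro π ⟨hπ, hπk⟩
    apply he
    rw [← stackPairings_partner hs hk hπ hπk, hπ.2.2.1]

/-- The point `k` either joins the stack or closes a point of it. -/
lemma ncard_stackPairings_succ {n : ℕ} (e : Fin n → Fin 2) (s : List (Fin n)) (k : Fin n)
    (hk : ∀ x ∈ s, x < k) :
    (stackPairings e s k).ncard = (stackPairings e (k :: s) (k + 1)).ncard +
      {π | π ∈ stackPairings e s k ∧ π k ∈ s}.ncard := by
  have hks : k ∉ s := fun h => lt_irrefl _ (hk _ h)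
  rw [← Set.ncard_union_eq]
  · congr 1
    ext π
    have hmem : ∀ x : Fin n, (x ∈ k :: s ∨ (k : ℕ) + 1 ≤ x) ↔ (x ∈ s ∨ (k : ℕ) ≤ x) := by
      intro x
      rw [List.mem_cons, Fin.ext_iff]
      constructor
      · rintro ((h | h) | h)
        · right; omega
        · exact Or.inl h
        · right; omega
      · rintro (h | h)
        · exact Or.inl (Or.inr h)
        · by_cases h' : (x : ℕ) = k
          · exact Or.inl (Or.inl h')
          · right; omega
    simp only [stackPairings, Set.mem_ofPred_eq, Set.mem_union, hmem]
    constructor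
    · rintro ⟨h1, h2, h3, h4, h5⟩
      by_cases hks' : π k ∈ s
      · exact Or.inr ⟨⟨h1, h2, h3, h4, h5⟩, hks'⟩
      · refine Or.inl ⟨h1, h2, h3, h4, fun x hx => ?_⟩
        have hkk := (h2 k).2 (Or.inr le_rfl)
        rcases List.mem_cons.1 hx with rfl | hx
        · simp [hkk, hks']
        · rw [List.mem_cons]
          rintro (h | h)
          · exact hks' (by rw [← h, h1]; exact hx)
          · exact h5 x hx h
    · rintro (⟨h1, h2, h3, h4, h5⟩ | h)
      · exact ⟨h1, h2, h3, h4, fun x hx h =>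
          h5 x (List.mem_cons_of_mem _ hx) (List.mem_cons_of_mem _ h)⟩
      · exact h.1
  · rw [Set.disjoint_left]
    rintro π ⟨-, -, -, -, h5⟩ ⟨-, h⟩
    exact h5 k List.mem_cons_self (List.mem_cons_of_mem _ h)

/-- Pushing and closing a point correspond to the two terms of `fockOp_cons`, with the colours of
the open points as the basis word. -/
lemma prod_fockOp_drop_eq_ncard {n : ℕ} (e : Fin n → Fin 2) (d k : ℕ) (hd : k + d = n)
    (s : List (Fin n)) (hs : s.Pairwise (· > ·)) (hk : ∀ x ∈ s, x.val < k) :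
    ((((List.ofFn e).drop k).map fockOp).prod vacuum) (s.map e) = (stackPairings e s k).ncard := by
  induction d generalizing k s with
  | zero =>
    obtain rfl : k = n := by omega
    rw [ncard_stackPairings_top, List.drop_of_length_le (by simp)]
    cases s <;> simp [vacuum]
  | succ d ih =>
    have hkn : k < n := by omega
    set κ : Fin n := ⟨k, hkn⟩
    have hdrop : (List.ofFn e).drop k = e κ :: (List.ofFn e).drop (k + 1) := by
      rw [List.drop_eq_getElem_cons (by simpa using hkn)]
      simp [κ]
    have hpush : (κ :: s).Pairwise (· > ·) := List.pairwise_cons.2 ⟨hk, hs⟩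
    have ihpush := ih (k + 1) (by omega) (κ :: s) hpush (by
      intro x hx
      rcases List.mem_cons.1 hx with rfl | hx
      · exact Nat.lt_succ_self _
      · exact (hk x hx).trans (Nat.lt_succ_self _))
    have hsucc := ncard_stackPairings_succ e s κ hk
    rw [hdrop, List.map_cons, List.prod_cons, Module.End.mul_apply, hsucc]
    push_cast
    cases s with
    | nil =>
      rw [List.map_nil, fockOp_nil]
      simpa using ihpush
    | cons j s =>
      rw [ncard_stackPairings_close e s j κ hs hk, List.map_cons, fockOp_cons]
      rw [List.map_cons, List.map_cons] at ihpush
      rw [ihpush, ih (k + 1) (by omega) s (List.pairwise_cons.1 hs).2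
        (fun x hx => (hk x (List.mem_cons_of_mem _ hx)).trans (Nat.lt_succ_self _))]
      push_cast
      rfl

/-- The mixed moments of the two semicircular operators in the vacuum state count the coloured
non-crossing pairings. -/
lemma prod_fockOp_vacuum_eq_ncard {n : ℕ} (e : Fin n → Fin 2) :
    (((List.ofFn e).map fockOp).prod vacuum) [] = (nonCrossingColouredPairings e).ncard := by
  have h := prod_fockOp_drop_eq_ncard e n 0 (by omega) [] (by simp) (by simp)
  simp only [List.drop_zero, List.map_nil] at h
  rw [h]
  congr 2
  ext π
  simp only [stackPairings, nonCrossingColouredPairings, colouredPairings, pairings,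
    Set.mem_ofPred_eq, List.not_mem_nil, false_or, Nat.zero_le, iff_true, false_imp_iff,
    implies_true, and_true, forall_and, and_assoc]

/-! ### Cycles of a permutation multiplied by a transposition -/

section Cycles

variable {n : ℕ} {ρ : Equiv.Perm (Fin n)} {a b : Fin n}

lemma Equiv.Perm.SameCycle.induction_closed {P : Fin n → Prop} (hP : ∀ x, P x → P (ρ x))
    {x y : Fin n} (h : ρ.SameCycle x y) (hx : P x) : P y := by
  obtain ⟨i, -, rfl⟩ := h.exists_pow_eq'
  clear h
  induction i with
  | zero => simpa using hx
  | succ i ih => rw [pow_succ', Equiv.Perm.mul_apply]; exact hP _ ih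

lemma mul_swap_apply_left : (ρ * Equiv.swap a b) a = ρ b := by simp

lemma mul_swap_apply_right : (ρ * Equiv.swap a b) b = ρ a := by simp

lemma mul_swap_apply_ne {x : Fin n} (ha : x ≠ a) (hb : x ≠ b) :
    (ρ * Equiv.swap a b) x = ρ x := by
  rw [Equiv.Perm.mul_apply, Equiv.swap_apply_of_ne_of_ne ha hb]

/-- Multiplication by `swap a b` does not change a path of `ρ` before it reaches `a` or `b`. -/
lemma sameCycle_mul_swap_of_reach {x c : Fin n} (h : ρ.SameCycle x c) (hc : c = a ∨ c = b) :
    (ρ * Equiv.swap a b).SameCycle x a ∨ (ρ * Equiv.swap a b).SameCycle x b := by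
  obtain ⟨i, -, hi⟩ := h.exists_pow_eq'
  clear h
  induction i generalizing x with
  | zero =>
    rw [pow_zero, Equiv.Perm.one_apply] at hi
    rcases hc with hc | hc
    · exact Or.inl (by rw [hi, hc])
    · exact Or.inr (by rw [hi, hc])
  | succ i ih =>
    by_cases hxa : x = a
    · exact Or.inl (by rw [hxa])
    by_cases hxb : x = b
    · exact Or.inr (by rw [hxb])
    have := ih (x := ρ x) (by rw [← hi, pow_succ, Equiv.Perm.mul_apply])
    rw [← mul_swap_apply_ne hxa hxb] at this
    simpa only [Equiv.Perm.sameCycle_apply_left] using this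

/-- If `a` and `b` lie in different cycles of `ρ`, then `ρ * swap a b` maps `a` to `ρ b` and
follows the cycle of `b` from there. -/
lemma sameCycle_mul_swap_of_not_sameCycle (h : ¬ ρ.SameCycle a b) :
    (ρ * Equiv.swap a b).SameCycle a b := by
  have key : ∀ (i : ℕ) (x : Fin n), (ρ ^ i) x = b → ¬ ρ.SameCycle x a →
      (ρ * Equiv.swap a b).SameCycle x b := by
    intro i
    induction i with
    | zero => intro x hx _; rw [pow_zero, Equiv.Perm.one_apply] at hx; rw [hx]
    | succ i ih =>
      intro x hx hxa
      by_cases hxb : x = b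
      · rw [hxb]
      have hne : x ≠ a := by rintro rfl; exact hxa (Equiv.Perm.SameCycle.refl _ _)
      have := ih (ρ x) (by rw [← hx, pow_succ, Equiv.Perm.mul_apply])
        (by rwa [Equiv.Perm.sameCycle_apply_left])
      rwa [← mul_swap_apply_ne hne hxb, Equiv.Perm.sameCycle_apply_left] at this
  have hb : ρ.SameCycle (ρ b) b := by
    rw [Equiv.Perm.sameCycle_apply_left]
  obtain ⟨i, -, hi⟩ := hb.exists_pow_eq'
  have := key i (ρ b) hi (by rw [Equiv.Perm.sameCycle_apply_left]; exact fun h' => h h'.symm)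
  rwa [← mul_swap_apply_left (a := a), Equiv.Perm.sameCycle_apply_left] at this

lemma not_sameCycle_mul_swap (hab : a ≠ b) (h : ρ.SameCycle a b) :
    ¬ (ρ * Equiv.swap a b).SameCycle b a := by
  classical
  obtain ⟨i, -, hi⟩ := h.exists_pow_eq'
  have hex : ∃ r, (ρ ^ r) a = b := ⟨i, hi⟩
  -- `C = {ρ a, …, ρ ^ r a = b}`, for the first arrival time `r` at `b`, does not contain `a`
  -- and is closed under `ρ * swap a b`, which maps `b` to `ρ a`.
  set r := Nat.find hex with hr
  have hrb : (ρ ^ r) a = b := Nat.find_spec hex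
  have hmin : ∀ j < r, (ρ ^ j) a ≠ b := fun j hj => Nat.find_min hex hj
  have hr0 : 1 ≤ r := by
    by_contra h0
    have : r = 0 := by omega
    rw [this] at hrb
    exact hab hrb
  intro hba
  have hC : ∃ j, 1 ≤ j ∧ j ≤ r ∧ (ρ ^ j) a = a := by
    refine hba.induction_closed (P := fun x => ∃ j, 1 ≤ j ∧ j ≤ r ∧ (ρ ^ j) a = x) ?_
      ⟨r, hr0, le_rfl, hrb⟩
    rintro x ⟨j, h1, h2, rfl⟩
    by_cases hxb : (ρ ^ j) a = b
    · exact ⟨1, le_rfl, hr0, by rw [hxb, mul_swap_apply_right, pow_one]⟩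
    · have hjr : j < r := lt_of_le_of_ne h2 (fun hh => hxb (hh ▸ hrb))
      by_cases hxa : (ρ ^ j) a = a
      · exfalso
        refine hmin (r - j) (by omega) ?_
        have : (ρ ^ (r - j)) ((ρ ^ j) a) = b := by
          rw [← Equiv.Perm.mul_apply, ← pow_add, Nat.sub_add_cancel h2, hrb]
        rwa [hxa] at this
      · exact ⟨j + 1, by omega, hjr, by
          rw [mul_swap_apply_ne hxa hxb, pow_succ', Equiv.Perm.mul_apply]⟩
  obtain ⟨j, h1, h2, hj⟩ := hC
  refine hmin (r - j) (by omega) ?_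
  have : (ρ ^ (r - j)) ((ρ ^ j) a) = b := by
    rw [← Equiv.Perm.mul_apply, ← pow_add, Nat.sub_add_cancel h2, hrb]
  rwa [hj] at this

/-- Multiplication by a transposition within a cycle splits this cycle into two. -/
lemma numCycles_mul_swap_of_sameCycle (hab : a ≠ b) (h : ρ.SameCycle a b) :
    numCycles (ρ * Equiv.swap a b) = numCycles ρ + 1 := by
  classical
  set ρ' := ρ * Equiv.swap a b with hρ'
  have hnot : ¬ ρ'.SameCycle b a := not_sameCycle_mul_swap hab h
  have hcoarse : ∀ {x y}, ρ'.SameCycle x y → ρ.SameCycle x y := by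
    intro x y hxy
    refine hxy.induction_closed (P := fun y => ρ.SameCycle x y) ?_ (Equiv.Perm.SameCycle.refl _ _)
    intro z hz
    by_cases hza : z = a
    · rw [hza, mul_swap_apply_left, Equiv.Perm.sameCycle_apply_right]
      exact (hza ▸ hz).trans h
    by_cases hzb : z = b
    · rw [hzb, mul_swap_apply_right, Equiv.Perm.sameCycle_apply_right]
      exact (hzb ▸ hz).trans h.symm
    rwa [mul_swap_apply_ne hza hzb, Equiv.Perm.sameCycle_apply_right]
  have hfine : ∀ {x y}, ρ.SameCycle x y → ¬ ρ.SameCycle x a → ρ'.SameCycle x y := by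
    intro x y hxy hxa
    have : ρ.SameCycle x y ∧ ρ'.SameCycle x y := by
      refine hxy.induction_closed (P := fun y => ρ.SameCycle x y ∧ ρ'.SameCycle x y) ?_
        ⟨Equiv.Perm.SameCycle.refl _ _, Equiv.Perm.SameCycle.refl _ _⟩
      rintro z ⟨hz, hz'⟩
      refine ⟨by rwa [Equiv.Perm.sameCycle_apply_right], ?_⟩
      have hza : z ≠ a := by rintro rfl; exact hxa hz
      have hzb : z ≠ b := by rintro rfl; exact hxa (hz.trans h.symm)
      rw [← mul_swap_apply_ne hza hzb]
      rwa [Equiv.Perm.sameCycle_apply_right]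
    exact this.2
  -- The cycles of `ρ'` other than that of `b` correspond to the cycles of `ρ`.
  set Q := Quotient (Equiv.Perm.SameCycle.setoid ρ)
  set Q' := Quotient (Equiv.Perm.SameCycle.setoid ρ')
  let F : Q' → Q := Quotient.map' id (fun x y hxy => hcoarse hxy)
  let b' : Q' := Quotient.mk'' b
  have hbij : Function.Bijective (fun q : {q : Q' // q ≠ b'} => F q.1) := by
    constructor
    · rintro ⟨x, hx⟩ ⟨y, hy⟩ hxy
      induction x using Quotient.inductionOn'
      induction y using Quotient.inductionOn'
      rename_i x y
      have hxy' : ρ.SameCycle x y := Quotient.eq''.1 hxy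
      have hx' : ¬ ρ'.SameCycle x b := fun hh => hx (Quotient.eq''.2 hh)
      have hy' : ¬ ρ'.SameCycle y b := fun hh => hy (Quotient.eq''.2 hh)
      apply Subtype.ext
      apply Quotient.eq''.2
      show ρ'.SameCycle x y
      by_cases hxa : ρ.SameCycle x a
      · have h1 := (sameCycle_mul_swap_of_reach (a := a) (b := b) hxa (Or.inl rfl)).resolve_right hx'
        have h2 := (sameCycle_mul_swap_of_reach (a := a) (b := b) (hxy'.symm.trans hxa)
          (Or.inl rfl)).resolve_right hy'
        exact h1.trans h2.symm
      · exact hfine hxy' hxa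
    · intro q
      induction q using Quotient.inductionOn'
      rename_i x
      by_cases hxb : ρ'.SameCycle x b
      · refine ⟨⟨Quotient.mk'' a, fun hh => hnot (Quotient.eq''.1 hh).symm⟩, ?_⟩
        exact Quotient.eq''.2 (h.trans (hcoarse hxb).symm)
      · exact ⟨⟨Quotient.mk'' x, fun hh => hxb (Quotient.eq''.1 hh)⟩, rfl⟩
  show Nat.card Q' = Nat.card Q + 1
  rw [← Nat.card_eq_of_bijective _ hbij]
  have : Fintype Q' := Fintype.ofFinite _
  rw [Nat.card_eq_fintype_card, Nat.card_eq_fintype_card, Fintype.card_subtype_compl,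
    Fintype.card_subtype_eq]
  have : 0 < Fintype.card Q' := Fintype.card_pos_iff.2 ⟨b'⟩
  omega

/-- Multiplication by a transposition of points in different cycles merges these cycles. -/
lemma numCycles_mul_swap_of_not_sameCycle (h : ¬ ρ.SameCycle a b) :
    numCycles (ρ * Equiv.swap a b) + 1 = numCycles ρ := by
  have hab : a ≠ b := by rintro rfl; exact h (Equiv.Perm.SameCycle.refl _ _)
  rw [← numCycles_mul_swap_of_sameCycle hab (sameCycle_mul_swap_of_not_sameCycle h), mul_assoc,
    Equiv.swap_mul_self, mul_one]

lemma numCycles_mul_swap_le (hab : a ≠ b) :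
    numCycles (ρ * Equiv.swap a b) ≤ numCycles ρ + 1 := by
  by_cases h : ρ.SameCycle a b
  · exact (numCycles_mul_swap_of_sameCycle hab h).le
  · have := numCycles_mul_swap_of_not_sameCycle h
    omega

end Cycles

/-! ### The genus inequality -/

section Genus

variable {n : ℕ} {π : Equiv.Perm (Fin n)}

lemma card_support_mul_swap {a b : Fin n} (hab : a ≠ b) (h1 : π a = b) (h2 : π b = a) :
    (π * Equiv.swap a b).support.card + 2 = π.support.card := by
  have : π.support = insert a (insert b (π * Equiv.swap a b).support) := by
    ext x
    simp only [Equiv.Perm.mem_support, Finset.mem_insert, mul_swap_apply_of_apply_eq h1 h2]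
    by_cases hxa : x = a
    · simp [hxa, h1, hab.symm]
    · by_cases hxb : x = b
      · simp [hxb, h2, hab]
      · simp [hxa, hxb]
  rw [this, Finset.card_insert_of_notMem, Finset.card_insert_of_notMem]
  · simp [h1]
  · simp [h2, hab]

lemma involutive_mul_swap {a b : Fin n} (hπ : Function.Involutive π) (h1 : π a = b) :
    Function.Involutive (π * Equiv.swap a b) := by
  have h2 : π b = a := by rw [← h1, hπ]
  intro x
  have hσa : ∀ x, π x = a → x = b := fun x hx => by rw [← hπ x, hx, h1]
  have hσb : ∀ x, π x = b → x = a := fun x hx => by rw [← hπ x, hx, h2]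
  have := hπ x
  rw [mul_swap_apply_of_apply_eq h1 h2 x, mul_swap_apply_of_apply_eq h1 h2]
  grind

/-- Induction over involutions: remove a pair. -/
lemma involutive_induction {P : Equiv.Perm (Fin n) → Prop} (h1 : P 1)
    (hs : ∀ (π : Equiv.Perm (Fin n)) (a b : Fin n), Function.Involutive π → a < b → π a = b →
      π b = a → P (π * Equiv.swap a b) → P π) (hπ : Function.Involutive π) : P π := by
  obtain ⟨k, hk⟩ : ∃ k, π.support.card = k := ⟨_, rfl⟩
  induction k using Nat.strong_induction_on generalizing π with
  | _ k ih =>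
    by_cases h : π = 1
    · exact h ▸ h1
    · have : ∃ a, a < π a := by
        obtain ⟨a, ha⟩ : ∃ a, π a ≠ a := by
          by_contra! hh
          exact h (Equiv.ext hh)
        rcases lt_or_gt_of_ne ha with h' | h'
        · exact ⟨π a, by rwa [hπ]⟩
        · exact ⟨a, h'⟩
      obtain ⟨a, ha⟩ := this
      have hcard := card_support_mul_swap ha.ne rfl (hπ a)
      exact hs π a (π a) hπ ha rfl (hπ a) (ih _ (by omega) (involutive_mul_swap hπ rfl) rfl)

/-- An involution is a product of half as many transpositions as its support has points, and each
of them adds at most one cycle. -/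
lemma two_mul_numCycles_mul_le (ρ : Equiv.Perm (Fin n)) (hπ : Function.Involutive π) :
    2 * numCycles (ρ * π) ≤ 2 * numCycles ρ + π.support.card := by
  refine involutive_induction (P := fun π => 2 * numCycles (ρ * π) ≤ 2 * numCycles ρ +
    π.support.card) (by simp) ?_ hπ
  · intro π a b hπ hab h1 h2 ih
    have hcard := card_support_mul_swap hab.ne h1 h2
    have := numCycles_mul_swap_le (ρ := ρ * (π * Equiv.swap a b)) hab.ne
    rw [mul_assoc, mul_assoc, Equiv.swap_mul_self, mul_one] at this
    omega

lemma numCycles_finRotate (hn : 1 ≤ n) : numCycles (finRotate n) = 1 := by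
  obtain ⟨m, rfl⟩ : ∃ m, n = m + 1 := ⟨n - 1, by omega⟩
  have h0 : ∀ x : Fin (m + 1), (finRotate (m + 1)).SameCycle 0 x := by
    intro x
    induction x using Fin.induction with
    | zero => exact Equiv.Perm.SameCycle.refl _ _
    | succ i ih =>
      have : i.succ = finRotate (m + 1) i.castSucc := by
        rw [finRotate_apply, Fin.coeSucc_eq_succ]
      rwa [this, Equiv.Perm.sameCycle_apply_right]
  rw [numCycles, Nat.card_eq_one_iff_unique]
  refine ⟨⟨fun x y => ?_⟩, ⟨Quotient.mk'' 0⟩⟩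
  induction x using Quotient.inductionOn'
  induction y using Quotient.inductionOn'
  exact Quotient.eq''.2 ((h0 _).symm.trans (h0 _))

lemma val_finRotate_of_lt {x b : Fin n} (h : x < b) : (finRotate n x).val = x.val + 1 := by
  obtain ⟨m, rfl⟩ : ∃ m, n = m + 1 := ⟨n - 1, by omega⟩
  exact coe_finRotate_of_ne_last (by rintro rfl; exact absurd h (not_lt.2 (Fin.le_last b)))

/-- The case of equality in the genus inequality: for `π a = b`, the permutation `γ π'`
left after removing the pair `a < b` has `a` and `b` in the same cycle, since the pairs of `π'` that
meet the interval `(a, b)` stay inside it. -/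
lemma NonCrossing.numCycles_eq (hn : 1 ≤ n) (hπ : Function.Involutive π) (hnc : NonCrossing π) :
    2 * numCycles (finRotate n * π) = 2 + π.support.card := by
  revert hnc
  refine involutive_induction (P := fun π => NonCrossing π →
    2 * numCycles (finRotate n * π) = 2 + π.support.card)
    (fun _ => by simp [numCycles_finRotate hn]) ?_ hπ
  · intro π a b hπ hab h1 h2 ih hnc
    have hcard := card_support_mul_swap hab.ne h1 h2
    have ih := ih (hnc.mul_swap h1 h2)
    set π' := π * Equiv.swap a b with hπ'
    have key := mul_swap_apply_of_apply_eq h1 h2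
    have hinv : Function.Involutive π' := involutive_mul_swap hπ h1
    -- Walk along `γ π'` from `a` towards `b`; at a point `p` of the walk, no pair of `π'` joins
    -- a point strictly between `a` and `p` to a point outside.
    have walk : ∀ (d : ℕ) (p : Fin n), a < p → p.val + d = b.val →
        (∀ x, a < x → x < p → a < π' x ∧ π' x < p) →
        (finRotate n * π').SameCycle p b := by
      intro d
      induction d using Nat.strong_induction_on with
      | _ d ihd =>
        intro p hap hpd hcl
        by_cases hpb : p = b
        · rw [hpb]
        have hpb' : p < b := by
          rw [Fin.lt_def]; have : p.val ≠ b.val := fun h => hpb (Fin.ext h)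
          omega
        have hπp : π' p = π p := by rw [key, if_neg hap.ne', if_neg hpb]
        have hge : p ≤ π' p := by
          by_contra! hlt
          have hne : a ≠ π' p := by
            intro h
            have h3 := hinv p
            rw [← h, key, if_pos rfl] at h3
            exact hap.ne h3
          rcases lt_or_gt_of_ne hne with h' | h'
          · have := (hcl _ h' hlt).2
            rw [hinv] at this
            exact lt_irrefl _ this
          · exact hnc ⟨π p, a, p, b, by rwa [← hπp], hap, hpb', hπ p, h1⟩
        have hlt : π' p < b := by
          by_contra! hle
          rcases hle.eq_or_lt with h' | h'
          · have h3 := hinv p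
            rw [← h', key, if_neg hab.ne', if_pos rfl] at h3
            exact hpb h3.symm
          · exact hnc ⟨a, p, b, π p, hap, hpb', by rwa [← hπp], h1, rfl⟩
        have hval := val_finRotate_of_lt hlt
        have hstep : (finRotate n * π').SameCycle (finRotate n (π' p)) b := by
          refine ihd (b.val - (π' p).val - 1) (by omega) _ ?_ (by omega) ?_
          · rw [Fin.lt_def] at *; omega
          · intro x hax hx
            have hx' : x ≤ π' p := by rw [Fin.le_def]; rw [Fin.lt_def] at hx; omega
            suffices a < π' x ∧ π' x ≤ π' p by
              refine ⟨this.1, ?_⟩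
              have := this.2
              rw [Fin.le_def] at this
              rw [Fin.lt_def]; omega
            rcases lt_trichotomy x p with hxp | rfl | hxp
            · have := hcl x hax hxp
              exact ⟨this.1, this.2.le.trans hge⟩
            · exact ⟨hap.trans_le hge, le_rfl⟩
            · rcases hx'.eq_or_lt with rfl | hxlt
              · rw [hinv]; exact ⟨hap, hge⟩
              · have hxb : x < b := hxlt.trans hlt
                have hπx : π' x = π x := by rw [key, if_neg hax.ne', if_neg hxb.ne]
                constructor
                · by_contra! hle
                  refine hnc ⟨π x, p, x, π p, ?_, hxp, by rwa [← hπp], hπ x, rfl⟩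
                  rw [← hπx]; exact hle.trans_lt hap
                · by_contra! hgt
                  exact hnc ⟨p, x, π p, π x, hxp, by rwa [← hπp], by rwa [← hπp, ← hπx], rfl, rfl⟩
        rwa [← Equiv.Perm.mul_apply, Equiv.Perm.sameCycle_apply_left] at hstep
    have hva := val_finRotate_of_lt hab
    have hsame : (finRotate n * π').SameCycle a b := by
      have hw := walk (b.val - a.val - 1) (finRotate n a)
        (by rw [Fin.lt_def]; omega) (by rw [Fin.lt_def] at hab; omega)
        (fun x hx hx' => by rw [Fin.lt_def] at hx hx'; omega)
      have : finRotate n a = (finRotate n * π') a := by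
        rw [Equiv.Perm.mul_apply, key, if_pos rfl]
      rwa [this, Equiv.Perm.sameCycle_apply_left] at hw
    have := numCycles_mul_swap_of_sameCycle hab.ne hsame
    rw [hπ', mul_assoc, mul_assoc, Equiv.swap_mul_self, mul_one] at this
    rw [hπ'] at hcard ih
    omega

/-- For a crossing `a < b < c < d`, multiplying the long cycle by `swap a c` separates `b` from
`d`, so that multiplying by `swap b d` merges two cycles. -/
lemma numCycles_lt_of_not_nonCrossing (hn : 1 ≤ n) (hπ : Function.Involutive π)
    (hc : ¬ NonCrossing π) : 2 * numCycles (finRotate n * π) < 2 + π.support.card := by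
  obtain ⟨a, b, c, d, hab, hbc, hcd, hac, hbd⟩ := not_not.1 hc
  have hca : π c = a := by rw [← hac, hπ]
  have hdb : π d = b := by rw [← hbd, hπ]
  have hac' : a < c := hab.trans hbc
  set π₁ := π * Equiv.swap a c with hπ₁
  have key := mul_swap_apply_of_apply_eq hac hca
  have h1 : π₁ b = d := by rw [key, if_neg hab.ne', if_neg hbc.ne, hbd]
  have h2 : π₁ d = b := by rw [key, if_neg (hac'.trans hcd).ne', if_neg hcd.ne', hdb]
  have hinv₁ : Function.Involutive π₁ := involutive_mul_swap hπ hac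
  have hinv₂ : Function.Involutive (π₁ * Equiv.swap b d) := involutive_mul_swap hinv₁ h1
  have hcard₁ := card_support_mul_swap hac'.ne hac hca
  have hcard₂ := card_support_mul_swap (hbc.trans hcd).ne h1 h2
  have hle : numCycles (finRotate n * Equiv.swap a c) ≤ 2 := by
    have := numCycles_mul_swap_le (ρ := finRotate n) hac'.ne
    rwa [numCycles_finRotate hn] at this
  have hsep : ¬ (finRotate n * Equiv.swap a c).SameCycle b d := by
    intro h
    have : a < d ∧ d ≤ c := by
      refine h.induction_closed (P := fun x => a < x ∧ x ≤ c) ?_ ⟨hab, hbc.le⟩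
      rintro x ⟨hax, hxc⟩
      rcases hxc.eq_or_lt with rfl | hxc
      · have := val_finRotate_of_lt hac'
        rw [mul_swap_apply_right]
        rw [Fin.lt_def, Fin.le_def, this]
        rw [Fin.lt_def] at hac'
        omega
      · have := val_finRotate_of_lt hxc
        rw [mul_swap_apply_ne hax.ne' hxc.ne]
        rw [Fin.lt_def, Fin.le_def, this]
        rw [Fin.lt_def] at hax hxc
        omega
    exact absurd this.2 (not_le.2 hcd)
  have hmerge := numCycles_mul_swap_of_not_sameCycle hsep
  have hbound := two_mul_numCycles_mul_le
    (finRotate n * Equiv.swap a c * Equiv.swap b d) hinv₂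
  have hprod : finRotate n * Equiv.swap a c * Equiv.swap b d * (π₁ * Equiv.swap b d) =
      finRotate n * π := by
    have hcomm : ∀ σ τ : Equiv.Perm (Fin n), Function.Involutive σ → Function.Involutive τ →
        Function.Involutive (σ * τ) → σ * τ = τ * σ := by
      intro σ τ hσ hτ hστ
      ext x : 1
      have := congrArg σ (hστ (τ x))
      simp only [Equiv.Perm.mul_apply] at this
      rw [hσ, hτ] at this
      simpa [Equiv.Perm.mul_apply] using (congrArg τ this).symm
    have e1 := hcomm π₁ (Equiv.swap b d) hinv₁ (Equiv.swap_apply_self b d) hinv₂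
    have e2 := hcomm π (Equiv.swap a c) hπ (Equiv.swap_apply_self a c) hinv₁
    rw [e1, hπ₁, e2]
    simp only [mul_assoc, Equiv.swap_mul_self_mul]
  rw [hprod] at hbound
  rw [← hπ₁] at hcard₁
  omega

end Genus

/-! ### Pairings of a subset -/

/-- The pairings of `S`, as the involutions of `Fin n` whose support is `S`. -/
def matchings {n : ℕ} (S : Finset (Fin n)) : Finset (Equiv.Perm (Fin n)) :=
  open Classical in Finset.univ.filter fun π => Function.Involutive π ∧ π.support = S

lemma mem_matchings {n : ℕ} {S : Finset (Fin n)} {π : Equiv.Perm (Fin n)} :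
    π ∈ matchings S ↔ Function.Involutive π ∧ π.support = S := by
  simp [matchings]

lemma matchings_empty {n : ℕ} : matchings (∅ : Finset (Fin n)) = {1} := by
  ext π
  rw [mem_matchings, Finset.mem_singleton, Equiv.Perm.support_eq_empty_iff]
  constructor
  · exact fun h => h.2
  · rintro rfl
    exact ⟨fun x => rfl, rfl⟩

/-- A pairing of `insert a S` consists of the partner `b` of `a` and a pairing of `S \ {b}`. -/
lemma sum_matchings_insert {n : ℕ} {M : Type*} [AddCommMonoid M] {S : Finset (Fin n)} {a : Fin n}
    (ha : a ∉ S) (f : Equiv.Perm (Fin n) → M) :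
    ∑ π ∈ matchings (insert a S), f π =
      ∑ b ∈ S, ∑ π ∈ matchings (S.erase b), f (π * Equiv.swap a b) := by
  rw [Finset.sum_sigma']
  refine Finset.sum_bij' (fun π _ => ⟨π a, π * Equiv.swap a (π a)⟩)
    (fun x _ => x.2 * Equiv.swap a x.1) ?_ ?_ ?_ ?_ ?_
  · intro π hπ
    rw [mem_matchings] at hπ
    obtain ⟨hinv, hsup⟩ := hπ
    have hne : π a ≠ a := by
      rw [← Equiv.Perm.mem_support, hsup]; exact Finset.mem_insert_self _ _
    have hmem : π a ∈ S := by
      have : π a ∈ π.support := by rw [Equiv.Perm.mem_support, hinv]; exact hne.symm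
      rw [hsup] at this
      exact (Finset.mem_insert.1 this).resolve_left hne
    rw [Finset.mem_sigma, mem_matchings]
    refine ⟨hmem, involutive_mul_swap hinv rfl, ?_⟩
    ext x
    have hx : π x ≠ x ↔ x = a ∨ x ∈ S := by
      rw [← Equiv.Perm.mem_support, hsup, Finset.mem_insert]
    rw [Equiv.Perm.mem_support, mul_swap_apply_of_apply_eq rfl (hinv a), Finset.mem_erase]
    by_cases hxa : x = a
    · simp [hxa, ha]
    · by_cases hxb : x = π a
      · rw [if_neg hxa, if_pos hxb]; simp [hxb]
      · rw [if_neg hxa, if_neg hxb, hx]; simp [hxa, hxb]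
  · rintro ⟨b, π⟩ hx
    simp only [Finset.mem_sigma, mem_matchings] at hx
    obtain ⟨hb, hinv, hsup⟩ := hx
    have hfix : ∀ x, x ∉ S.erase b → π x = x := fun x hx => by
      rwa [← hsup, Equiv.Perm.notMem_support] at hx
    have hab : a ≠ b := by rintro rfl; exact ha hb
    have hπa := hfix a (by simp [ha])
    have hπb := hfix b (by simp)
    have key := mul_swap_apply_of_fixed hπa hπb
    rw [mem_matchings]
    constructor
    · intro x
      have hσa : ∀ x, π x = a → x = a := fun x hx => by rw [← hinv x, hx, hπa]
      have hσb : ∀ x, π x = b → x = b := fun x hx => by rw [← hinv x, hx, hπb]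
      have := hinv x
      rw [key x, key]
      grind
    · ext x
      have hx : π x ≠ x ↔ x ∈ S.erase b := by rw [← Equiv.Perm.mem_support, hsup]
      rw [Equiv.Perm.mem_support, key, Finset.mem_insert]
      by_cases hxa : x = a
      · simp [hxa, hab.symm]
      · by_cases hxb : x = b
        · simp [hxb, hab, hab.symm, hb]
        · rw [if_neg hxa, if_neg hxb, hx]; simp [hxa, hxb]
  · intro π _
    simp only [mul_assoc, Equiv.swap_mul_self, mul_one]
  · rintro ⟨b, π⟩ hx
    simp only [Finset.mem_sigma, mem_matchings] at hx
    obtain ⟨hb, hinv, hsup⟩ := hx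
    have hπb : π b = b := by
      rw [← Equiv.Perm.notMem_support, hsup]; simp
    have h1 : (π * Equiv.swap a b) a = b := by simp [hπb]
    refine Sigma.ext h1 (heq_of_eq ?_)
    simp only [h1, mul_assoc, Equiv.swap_mul_self, mul_one]
  · intro π _
    simp only [mul_assoc, Equiv.swap_mul_self, mul_one]

/-! ### Gaussian integration by parts and the Wick formula -/

/-- The moments of the centred real Gaussian law of variance `v`. -/
def gaussianMoment (v : ℝ≥0) (k : ℕ) : ℂ := ∫ x, (x : ℂ) ^ k ∂gaussianReal 0 v

lemma integrable_pow_gaussianReal (v : ℝ≥0) (k : ℕ) :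
    Integrable (fun x : ℝ => x ^ k) (gaussianReal 0 v) := by
  have h : MemLp (fun x : ℝ => x) k (gaussianReal 0 v) := by
    exact_mod_cast memLp_id_gaussianReal (μ := 0) (v := v) (k : ℝ≥0)
  have h2 := h.integrable_norm_pow'
  refine h2.mono' (by fun_prop) (ae_of_all _ fun x => ?_)
  simp

lemma integrable_ofReal_pow_gaussianReal (v : ℝ≥0) (k : ℕ) :
    Integrable (fun x : ℝ => (x : ℂ) ^ k) (gaussianReal 0 v) := by
  simpa using (integrable_pow_gaussianReal v k).ofReal (𝕜 := ℂ)

lemma gaussianMoment_zero (v : ℝ≥0) : gaussianMoment v 0 = 1 := by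
  simp [gaussianMoment]

lemma gaussianMoment_eq_ofReal (v : ℝ≥0) (k : ℕ) :
    gaussianMoment v k = ((∫ x, x ^ k ∂gaussianReal 0 v : ℝ) : ℂ) := by
  rw [gaussianMoment, ← integral_complex_ofReal]
  simp

/-- Integration by parts: `x ^ k` times the density is a primitive of an integrable function, so
that the integral of its derivative vanishes. For `k = 0` the truncated exponent `k - 1` is
harmless, as its moment is multiplied by `0`. -/
lemma gaussianMoment_succ {v : ℝ≥0} (hv : v ≠ 0) (k : ℕ) :
    gaussianMoment v (k + 1) = v * (k * gaussianMoment v (k - 1)) := by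
  have hv' : (v : ℝ) ≠ 0 := by exact_mod_cast hv
  have hint : ∀ j : ℕ, Integrable (fun x : ℝ => gaussianPDFReal 0 v x * x ^ j) := by
    intro j
    have h := integrable_pow_gaussianReal v j
    rw [gaussianReal_of_var_ne_zero 0 hv, gaussianPDF_def,
      integrable_withDensity_iff_integrable_smul₀' (by fun_prop) (by simp)] at h
    refine h.congr (ae_of_all _ fun x => ?_)
    simp [ENNReal.toReal_ofReal (gaussianPDFReal_nonneg 0 v x)]
  have hpdf : ∀ x, HasDerivAt (gaussianPDFReal 0 v) (-(x / v) * gaussianPDFReal 0 v x) x := by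
    intro x
    have h1 : HasDerivAt (fun x : ℝ => -(x - 0) ^ 2 / (2 * v)) (-(x / v)) x := by
      have := ((((hasDerivAt_id x).sub_const 0).pow 2).neg).div_const (2 * (v : ℝ))
      refine this.congr_deriv ?_
      simp; field_simp
    have h2 := (h1.exp.const_mul (√(2 * Real.pi * v))⁻¹)
    refine h2.congr_deriv ?_
    rw [gaussianPDFReal]; ring
  have hder : ∀ x, HasDerivAt (fun x => gaussianPDFReal 0 v x * x ^ k)
      (k * (gaussianPDFReal 0 v x * x ^ (k - 1)) -
        (v : ℝ)⁻¹ * (gaussianPDFReal 0 v x * x ^ (k + 1))) x := by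
    intro x
    refine ((hpdf x).mul (hasDerivAt_pow k x)).congr_deriv ?_
    field_simp
    ring
  have h0 := integral_eq_zero_of_hasDerivAt_of_integrable hder
    (((hint (k - 1)).const_mul _).sub ((hint (k + 1)).const_mul _)) (hint k)
  rw [integral_sub ((hint (k - 1)).const_mul _) ((hint (k + 1)).const_mul _),
    integral_const_mul, integral_const_mul] at h0
  have hM : ∀ j : ℕ, ∫ x, x ^ j ∂gaussianReal 0 v = ∫ x, gaussianPDFReal 0 v x * x ^ j := by
    intro j
    rw [integral_gaussianReal_eq_integral_smul hv]
    rfl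
  rw [gaussianMoment_eq_ofReal, gaussianMoment_eq_ofReal, hM, hM]
  have : ∫ x, gaussianPDFReal 0 v x * x ^ (k + 1) =
      v * (k * ∫ x, gaussianPDFReal 0 v x * x ^ (k - 1)) := by
    field_simp at h0
    linarith
  exact_mod_cast this

lemma pderiv_prod {T K : Type*} [DecidableEq K] (t : T) (S : Finset K) (f : K → MvPolynomial T ℂ) :
    MvPolynomial.pderiv t (∏ k ∈ S, f k) =
      ∑ b ∈ S, MvPolynomial.pderiv t (f b) * ∏ k ∈ S.erase b, f k := by
  induction S using Finset.induction_on with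
  | empty => simp
  | insert a S ha ih =>
    rw [Finset.prod_insert ha, Derivation.leibniz, ih, Finset.sum_insert ha,
      Finset.erase_insert ha, smul_eq_mul, smul_eq_mul, Finset.mul_sum, add_comm, mul_comm]
    congr 1
    refine Finset.sum_congr rfl fun b hb => ?_
    have hab : a ≠ b := by rintro rfl; exact ha hb
    rw [Finset.erase_insert_of_ne hab, Finset.prod_insert (by simp [ha])]
    ring

section Wick

variable {T : Type*} [Fintype T] {Ω : Type*} [MeasurableSpace Ω]

/-- All mixed moments of the family `g` agree with those of independent centred real Gaussians of
variance `v`. -/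
def HasGaussianMoments (μ : Measure Ω) (g : T → Ω → ℝ) (v : ℝ≥0) : Prop :=
  ∀ m : T → ℕ, Integrable (fun ω => ∏ t, (g t ω : ℂ) ^ m t) μ ∧
    ∫ ω, ∏ t, (g t ω : ℂ) ^ m t ∂μ = ∏ t, gaussianMoment v (m t)

variable {μ : Measure Ω} {g : T → Ω → ℝ} {v : ℝ≥0}

lemma eval_monomial_eq_prod (m : T →₀ ℕ) (c : ℂ) (x : T → ℂ) :
    MvPolynomial.eval x (MvPolynomial.monomial m c) = c * ∏ t, x t ^ m t := by
  rw [MvPolynomial.eval_monomial, Finsupp.prod_fintype _ _ (fun t => pow_zero _)]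

lemma HasGaussianMoments.integrable_eval (h : HasGaussianMoments μ g v) (q : MvPolynomial T ℂ) :
    Integrable (fun ω => MvPolynomial.eval (fun t => (g t ω : ℂ)) q) μ := by
  induction q using MvPolynomial.induction_on' with
  | monomial m c =>
    simp only [eval_monomial_eq_prod]
    exact (h m).1.const_mul c
  | add p q hp hq =>
    simp only [map_add]
    exact hp.add hq

/-- Gaussian integration by parts for polynomials. -/
lemma HasGaussianMoments.integral_X_mul (h : HasGaussianMoments μ g v) (hv : v ≠ 0) (t : T)
    (q : MvPolynomial T ℂ) :
    ∫ ω, MvPolynomial.eval (fun t => (g t ω : ℂ)) (MvPolynomial.X t * q) ∂μ =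
      v * ∫ ω, MvPolynomial.eval (fun t => (g t ω : ℂ)) (MvPolynomial.pderiv t q) ∂μ := by
  classical
  induction q using MvPolynomial.induction_on' with
  | monomial m c =>
    rw [MvPolynomial.pderiv_monomial, MvPolynomial.X, MvPolynomial.monomial_mul]
    simp only [eval_monomial_eq_prod, integral_const_mul]
    rw [(h _).2, (h _).2, ← Finset.mul_prod_erase _ _ (Finset.mem_univ t),
      ← Finset.mul_prod_erase _ _ (Finset.mem_univ t)]
    have h1 : (Finsupp.single t 1 + m : T →₀ ℕ) t = m t + 1 := by simp [add_comm]
    have h2 : (m - Finsupp.single t 1 : T →₀ ℕ) t = m t - 1 := by simp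
    have h3 : ∏ x ∈ Finset.univ.erase t, gaussianMoment v ((Finsupp.single t 1 + m : T →₀ ℕ) x) =
        ∏ x ∈ Finset.univ.erase t, gaussianMoment v ((m - Finsupp.single t 1 : T →₀ ℕ) x) := by
      refine Finset.prod_congr rfl fun x hx => ?_
      have := Finset.ne_of_mem_erase hx
      simp [this.symm]
    rw [h1, h2, h3, gaussianMoment_succ hv]
    ring
  | add p q hp hq =>
    rw [mul_add]
    simp only [map_add]
    rw [integral_add (h.integrable_eval _) (h.integrable_eval _),
      integral_add (h.integrable_eval _) (h.integrable_eval _), hp, hq, mul_add]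

/-- The linear form with coefficients `A`. -/
def linearForm (A : T → ℂ) : MvPolynomial T ℂ := ∑ t, MvPolynomial.C (A t) * MvPolynomial.X t

lemma pderiv_linearForm (A : T → ℂ) (t : T) :
    MvPolynomial.pderiv t (linearForm A) = MvPolynomial.C (A t) := by
  classical
  simp [linearForm, MvPolynomial.pderiv_X, Pi.single_apply]

/-- Gaussian integration by parts, for a product of linear forms. -/
lemma HasGaussianMoments.integral_linearForm_mul_prod {K : Type*} [DecidableEq K]
    (h : HasGaussianMoments μ g v) (hv : v ≠ 0) (A : K → T → ℂ) (a : K) (S : Finset K) :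
    ∫ ω, MvPolynomial.eval (fun t => (g t ω : ℂ))
        (linearForm (A a) * ∏ k ∈ S, linearForm (A k)) ∂μ =
      ∑ b ∈ S, (v * ∑ t, A a t * A b t) * ∫ ω, MvPolynomial.eval (fun t => (g t ω : ℂ))
        (∏ k ∈ S.erase b, linearForm (A k)) ∂μ := by
  set Q := ∏ k ∈ S, linearForm (A k) with hQ
  have hder : ∀ t, MvPolynomial.pderiv t Q =
      ∑ b ∈ S, MvPolynomial.C (A b t) * ∏ k ∈ S.erase b, linearForm (A k) := by
    intro t
    simp only [hQ, pderiv_prod, pderiv_linearForm]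
  have hexp : linearForm (A a) * Q =
      ∑ t, MvPolynomial.C (A a t) * (MvPolynomial.X t * Q) := by
    rw [linearForm, Finset.sum_mul]
    exact Finset.sum_congr rfl fun t _ => mul_assoc _ _ _
  rw [hexp]
  simp only [map_sum, map_mul _ (MvPolynomial.C _), MvPolynomial.eval_C]
  rw [integral_finsetSum _ fun t _ => (h.integrable_eval (MvPolynomial.X t * Q)).const_mul _]
  simp only [integral_const_mul, h.integral_X_mul hv, hder]
  simp only [map_sum, map_mul _ (MvPolynomial.C _), MvPolynomial.eval_C]
  have h2 : ∀ t, ∫ ω, ∑ b ∈ S, A b t * MvPolynomial.eval (fun t => (g t ω : ℂ))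
      (∏ k ∈ S.erase b, linearForm (A k)) ∂μ = ∑ b ∈ S, A b t *
        ∫ ω, MvPolynomial.eval (fun t => (g t ω : ℂ)) (∏ k ∈ S.erase b, linearForm (A k)) ∂μ := by
    intro t
    rw [integral_finsetSum _ fun b _ => (h.integrable_eval _).const_mul _]
    simp only [integral_const_mul]
  simp only [h2]
  simp only [Finset.mul_sum, Finset.sum_mul]
  rw [Finset.sum_comm]
  refine Finset.sum_congr rfl fun b _ => Finset.sum_congr rfl fun t _ => ?_
  ring

/-- The Wick formula: the expectation of a product of centred jointly Gaussian variables is the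
sum over all pairings of the products of the covariances. The covariance of the `k`-th and `l`-th
variables is given in the form `c k l * c l k`, so that the product over the pairs becomes a
product over all points. -/
lemma HasGaussianMoments.wick {n : ℕ} (h : HasGaussianMoments μ g v) (hv : v ≠ 0)
    (A : Fin n → T → ℂ) (c : Fin n → Fin n → ℂ)
    (hc : ∀ k l, v * ∑ t, A k t * A l t = c k l * c l k) (S : Finset (Fin n)) :
    ∫ ω, MvPolynomial.eval (fun t => (g t ω : ℂ)) (∏ k ∈ S, linearForm (A k)) ∂μ =
      ∑ π ∈ matchings S, ∏ k ∈ S, c k (π k) := by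
  induction S using Finset.strongInduction with
  | H S ih =>
    rcases S.eq_empty_or_nonempty with rfl | ⟨a, ha⟩
    · have := h 0
      simp only [Pi.zero_apply, pow_zero, Finset.prod_const_one, gaussianMoment_zero] at this
      simp [matchings_empty, this.2]
    · obtain ⟨S, haS, rfl⟩ : ∃ S', a ∉ S' ∧ insert a S' = S :=
        ⟨S.erase a, Finset.notMem_erase a S, Finset.insert_erase ha⟩
      rw [Finset.prod_insert haS, h.integral_linearForm_mul_prod hv, sum_matchings_insert haS]
      refine Finset.sum_congr rfl fun b hb => ?_
      rw [ih _ ((Finset.erase_subset b S).trans_ssubset (Finset.ssubset_insert haS)), hc,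
        Finset.mul_sum]
      refine Finset.sum_congr rfl fun π hπ => ?_
      rw [mem_matchings] at hπ
      have hfix : ∀ x, x ∉ S.erase b → π x = x := fun x hx => by
        rwa [← hπ.2, Equiv.Perm.notMem_support] at hx
      have hab : a ≠ b := by rintro rfl; exact haS hb
      have key := mul_swap_apply_of_fixed (hfix a (by simp [haS])) (hfix b (by simp))
      rw [Finset.prod_insert haS, ← Finset.mul_prod_erase S _ hb, key, key, if_pos rfl,
        if_neg hab.symm, if_pos rfl, mul_assoc]
      congr 2
      refine Finset.prod_congr rfl fun k hk => ?_
      rw [Finset.mem_erase] at hk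
      rw [key, if_neg (by rintro rfl; exact haS hk.2), if_neg hk.1]

end Wick

/-! ### Gaussian coordinates of GUE matrices -/

section Coordinates

variable {N : ℕ}

/-- The law of the real and imaginary parts of the entries of a Ginibre matrix. -/
def ginibreParts (N : ℕ) : Measure (Fin N → Fin N → ℝ × ℝ) :=
  Measure.pi fun _ => Measure.pi fun _ =>
    (gaussianReal 0 (N : ℝ≥0)⁻¹).prod (gaussianReal 0 (N : ℝ≥0)⁻¹)

instance (N : ℕ) : IsProbabilityMeasure (ginibreParts N) := by
  unfold ginibreParts; infer_instance

/-- The matrix `(Z + Z*) / 2`, in terms of the real and imaginary parts of the entries of `Z`. -/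
def hermitianPart (z : Fin N → Fin N → ℝ × ℝ) : Matrix (Fin N) (Fin N) ℂ :=
  fun i j => (1 / 2 : ℂ) * (((z i j).1 + (z i j).2 * Complex.I) +
    ((z j i).1 - (z j i).2 * Complex.I))

lemma measurable_matrix_iff {α : Type*} [MeasurableSpace α] {f : α → Matrix (Fin N) (Fin N) ℂ} :
    Measurable f ↔ ∀ i j, Measurable fun a => f a i j := by
  exact measurable_pi_iff.trans (forall_congr' fun i => measurable_pi_iff)

lemma measurable_entry (i j : Fin N) : Measurable fun x : Matrix (Fin N) (Fin N) ℂ => x i j :=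
  measurable_matrix_iff.1 measurable_id i j

lemma measurable_hermitianPart : Measurable (hermitianPart (N := N)) := by
  rw [measurable_matrix_iff]
  intro i j
  unfold hermitianPart
  fun_prop

lemma gueLaw_eq_map : gueLaw N = (ginibreParts N).map hermitianPart := by
  have hc : Measurable fun x : ℝ × ℝ => (x.1 : ℂ) + (x.2 : ℂ) * Complex.I := by fun_prop
  have h1 : ginibreLaw N = (ginibreParts N).map
      fun z => Matrix.of fun i j => ((z i j).1 : ℂ) + (z i j).2 * Complex.I := by
    unfold ginibreLaw ginibreParts complexGaussian
    have hp : ∀ _ : Fin N, IsProbabilityMeasure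
        (((gaussianReal 0 (N : ℝ≥0)⁻¹).prod (gaussianReal 0 (N : ℝ≥0)⁻¹)).map
          fun x : ℝ × ℝ => (x.1 : ℂ) + (x.2 : ℂ) * Complex.I) :=
      fun _ => Measure.isProbabilityMeasure_map hc.aemeasurable
    rw [← Measure.pi_map_pi (fun _ => hc.aemeasurable)]
    have hc' : Measurable fun (x : Fin N → ℝ × ℝ) (i : Fin N) =>
        ((x i).1 : ℂ) + ((x i).2 : ℂ) * Complex.I := by fun_prop
    have hp' : ∀ _ : Fin N, IsProbabilityMeasure ((Measure.pi fun _ : Fin N =>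
        (gaussianReal 0 (N : ℝ≥0)⁻¹).prod (gaussianReal 0 (N : ℝ≥0)⁻¹)).map
          fun x (i : Fin N) => ((x i).1 : ℂ) + ((x i).2 : ℂ) * Complex.I) :=
      fun _ => Measure.isProbabilityMeasure_map hc'.aemeasurable
    rw [← Measure.pi_map_pi (fun _ => hc'.aemeasurable), Measure.map_map]
    · rfl
    · exact measurable_matrix_iff.2 fun i j => by simp only [Matrix.of_apply]; fun_prop
    · fun_prop
  rw [gueLaw, h1, Measure.map_map]
  · congr 1
    ext z i j
    simp [hermitianPart, mul_add]
    ring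
  · rw [measurable_matrix_iff]
    intro i j
    simp only [Matrix.smul_apply, Matrix.add_apply, Matrix.conjTranspose_apply, smul_eq_mul]
    have := measurable_entry (N := N) i j
    have := measurable_entry (N := N) j i
    fun_prop
  · exact measurable_matrix_iff.2 fun i j => by simp only [Matrix.of_apply]; fun_prop

instance (N : ℕ) : IsProbabilityMeasure (gueLaw N) := by
  rw [gueLaw_eq_map]
  exact Measure.isProbabilityMeasure_map measurable_hermitianPart.aemeasurable

/-- The independent real Gaussians underlying a pair of Ginibre matrices. The index consists of the
matrix, the row, the column, and the choice between real part (`0`) and imaginary part (`1`). -/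
def partCoord (N : ℕ) (t : Fin 2 × Fin N × Fin N × Fin 2)
    (z : (Fin N → Fin N → ℝ × ℝ) × (Fin N → Fin N → ℝ × ℝ)) : ℝ :=
  let x := ![z.1, z.2] t.1 t.2.1 t.2.2.1
  ![x.1, x.2] t.2.2.2

lemma hasGaussianMoments_partCoord (N : ℕ) :
    HasGaussianMoments ((ginibreParts N).prod (ginibreParts N)) (partCoord N) (N : ℝ≥0)⁻¹ := by
  intro m
  have hprod : ∀ z, ∏ t, (partCoord N t z : ℂ) ^ m t =
      (∏ i, ∏ j, (((z.1 i j).1 : ℂ) ^ m (0, i, j, 0) * ((z.1 i j).2 : ℂ) ^ m (0, i, j, 1))) *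
        ∏ i, ∏ j, (((z.2 i j).1 : ℂ) ^ m (1, i, j, 0) * ((z.2 i j).2 : ℂ) ^ m (1, i, j, 1)) := by
    intro z
    simp [Fintype.prod_prod_type, Fin.prod_univ_two, partCoord]
  simp only [hprod]
  have hint := fun k => integrable_ofReal_pow_gaussianReal (N : ℝ≥0)⁻¹ k
  constructor
  · refine Integrable.mul_prod (Integrable.fintype_prod (fun i => Integrable.fintype_prod
      (f := fun j (x : ℝ × ℝ) => (x.1 : ℂ) ^ m (0, i, j, 0) * (x.2 : ℂ) ^ m (0, i, j, 1))
      fun j => ?_)) (Integrable.fintype_prod (fun i => Integrable.fintype_prod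
      (f := fun j (x : ℝ × ℝ) => (x.1 : ℂ) ^ m (1, i, j, 0) * (x.2 : ℂ) ^ m (1, i, j, 1))
      fun j => ?_))
    · exact (hint _).mul_prod (hint _)
    · exact (hint _).mul_prod (hint _)
  · have hone : ∀ c : Fin 2, ∫ z : Fin N → Fin N → ℝ × ℝ,
        ∏ i, ∏ j, (((z i j).1 : ℂ) ^ m (c, i, j, 0) * ((z i j).2 : ℂ) ^ m (c, i, j, 1))
          ∂ginibreParts N = ∏ i, ∏ j, (gaussianMoment (N : ℝ≥0)⁻¹ (m (c, i, j, 0)) *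
            gaussianMoment (N : ℝ≥0)⁻¹ (m (c, i, j, 1))) := by
      intro c
      rw [ginibreParts, integral_fintype_prod_eq_prod (𝕜 := ℂ) (fun i (x : Fin N → ℝ × ℝ) =>
        ∏ j, (((x j).1 : ℂ) ^ m (c, i, j, 0) * ((x j).2 : ℂ) ^ m (c, i, j, 1)))]
      refine Finset.prod_congr rfl fun i _ => ?_
      rw [integral_fintype_prod_eq_prod (𝕜 := ℂ) (fun j (x : ℝ × ℝ) =>
        ((x.1 : ℂ) ^ m (c, i, j, 0) * (x.2 : ℂ) ^ m (c, i, j, 1)))]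
      refine Finset.prod_congr rfl fun j _ => ?_
      exact integral_prod_mul (fun x : ℝ => (x : ℂ) ^ m (c, i, j, 0))
        (fun x : ℝ => (x : ℂ) ^ m (c, i, j, 1))
    refine (integral_prod_mul (fun z : Fin N → Fin N → ℝ × ℝ => ∏ i, ∏ j,
      (((z i j).1 : ℂ) ^ m (0, i, j, 0) * ((z i j).2 : ℂ) ^ m (0, i, j, 1)))
      (fun z : Fin N → Fin N → ℝ × ℝ => ∏ i, ∏ j,
      (((z i j).1 : ℂ) ^ m (1, i, j, 0) * ((z i j).2 : ℂ) ^ m (1, i, j, 1)))).trans ?_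
    rw [hone, hone]
    simp [Fintype.prod_prod_type, Fin.prod_univ_two]

/-- The coefficients of the `(i, j)` entry of the GUE matrix with index `c`, as a linear form in
the coordinates `partCoord`. -/
def entryCoeff (c : Fin 2) (i j : Fin N) : Fin 2 × Fin N × Fin N × Fin 2 → ℂ := fun t =>
  (1 / 2 : ℂ) * ((if t = (c, i, j, 0) then 1 else 0) +
    (if t = (c, i, j, 1) then 1 else 0) * Complex.I + ((if t = (c, j, i, 0) then 1 else 0) -
      (if t = (c, j, i, 1) then 1 else 0) * Complex.I))

lemma eval_linearForm {T : Type*} [Fintype T] (A : T → ℂ) (x : T → ℂ) :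
    MvPolynomial.eval x (linearForm A) = ∑ t, A t * x t := by
  simp [linearForm]

lemma eval_entryCoeff (c : Fin 2) (i j : Fin N)
    (z : (Fin N → Fin N → ℝ × ℝ) × (Fin N → Fin N → ℝ × ℝ)) :
    MvPolynomial.eval (fun t => (partCoord N t z : ℂ)) (linearForm (entryCoeff c i j)) =
      ![hermitianPart z.1, hermitianPart z.2] c i j := by
  rw [eval_linearForm]
  simp only [entryCoeff, mul_assoc, add_mul, sub_mul, ite_mul, one_mul, zero_mul,
    ← Finset.mul_sum, Finset.sum_add_distrib, Finset.sum_sub_distrib, Finset.sum_ite_eq',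
    Finset.mem_univ, if_true]
  fin_cases c <;> simp [hermitianPart, partCoord] <;> ring

/-- Up to the factor `1 / N`, this is the covariance `𝔼[X_{ij} X_{kl}] = δ_{il} δ_{jk} / N`. -/
lemma sum_entryCoeff_mul (c c' : Fin 2) (i j k l : Fin N) :
    ∑ t, entryCoeff c i j t * entryCoeff c' k l t =
      if c = c' ∧ i = l ∧ j = k then 1 else 0 := by
  have h : ∑ t, entryCoeff c i j t * entryCoeff c' k l t =
      (1 / 2 : ℂ) * ((entryCoeff c' k l (c, i, j, 0) +
        entryCoeff c' k l (c, i, j, 1) * Complex.I) + (entryCoeff c' k l (c, j, i, 0) -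
          entryCoeff c' k l (c, j, i, 1) * Complex.I)) := by
    conv_lhs => enter [2, t]; rw [mul_comm, entryCoeff.eq_def c i j]
    simp only [mul_add, mul_sub, mul_ite, mul_one, mul_zero, ite_mul, zero_mul,
      Finset.sum_add_distrib, Finset.sum_sub_distrib,
      Finset.sum_ite_eq', Finset.mem_univ, if_true]
    ring
  rw [h]
  simp only [entryCoeff, Prod.mk.injEq]
  by_cases hc : c = c'
  · have e1 : (j = k ∧ i = l) ↔ (i = l ∧ j = k) := and_comm
    have e2 : (j = l ∧ i = k) ↔ (i = k ∧ j = l) := and_comm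
    simp only [hc, true_and, and_true, ← and_assoc, one_ne_zero, zero_ne_one, and_false,
      if_false, e1, e2]
    linear_combination (1 / 2 : ℂ) * ((if i = k ∧ j = l then 1 else 0) -
      (if i = l ∧ j = k then 1 else 0)) * Complex.I_sq
  · simp [hc]

end Coordinates

/-! ### The trace of a word as a sum over closed paths -/

section Trace

variable {N : ℕ}

/-- An entry of a product of `n + 1` matrices, as a sum over paths from `a` to `b` with `n`
intermediate points `i`. -/
lemma ofFn_prod_apply (n : ℕ) (A : Fin (n + 1) → Matrix (Fin N) (Fin N) ℂ) (a b : Fin N) :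
    (List.ofFn A).prod a b = ∑ i : Fin n → Fin N,
      ∏ k, A k (Fin.cons (α := fun _ => Fin N) a i k) (Fin.snoc (α := fun _ => Fin N) i b k) := by
  induction n generalizing a with
  | zero =>
    rw [List.ofFn_succ, List.ofFn_zero, List.prod_cons, List.prod_nil, mul_one,
      Fintype.sum_unique, Fin.prod_univ_succ, Fin.prod_univ_zero, mul_one]
    rfl
  | succ n ih =>
    rw [List.ofFn_succ, List.prod_cons, Matrix.mul_apply,
      ← (Fin.consEquiv fun _ => Fin N).sum_comp, Fintype.sum_prod_type]
    refine Finset.sum_congr rfl fun c _ => ?_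
    rw [ih, Finset.mul_sum]
    refine Finset.sum_congr rfl fun i _ => ?_
    have h0 : (Fin.snoc (α := fun _ => Fin N) (Fin.cons (α := fun _ => Fin N) c i) b 0 : Fin N) =
        c := by
      rw [← Fin.cons_snoc_eq_snoc_cons, Fin.cons_zero]
    refine Eq.trans ?_ (Fin.prod_univ_succ _).symm
    refine congrArg₂ (· * ·) (congrArg (A 0 a) h0.symm) (Finset.prod_congr rfl fun k _ => ?_)
    refine congrArg (A k.succ (Fin.cons (α := fun _ => Fin N) c i k)) ?_
    exact congrFun (Fin.cons_snoc_eq_snoc_cons c i b) k.succ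

lemma trace_ofFn_prod {n : ℕ} (hn : 1 ≤ n) (A : Fin n → Matrix (Fin N) (Fin N) ℂ) :
    (List.ofFn A).prod.trace =
      ∑ i : Fin n → Fin N, ∏ k, A k (i k) (i (finRotate n k)) := by
  obtain ⟨m, rfl⟩ : ∃ m, n = m + 1 := ⟨n - 1, by omega⟩
  rw [Matrix.trace, ← (Fin.consEquiv fun _ => Fin N).sum_comp, Fintype.sum_prod_type]
  refine Finset.sum_congr rfl fun a _ => ?_
  rw [Matrix.diag_apply, ofFn_prod_apply]
  refine Finset.sum_congr rfl fun i _ => Finset.prod_congr rfl fun k _ => ?_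
  simp only [Fin.consEquiv_apply]
  congr 1
  induction k using Fin.lastCases with
  | last => rw [Fin.snoc_last, finRotate_last, Fin.cons_zero]
  | cast k => rw [Fin.snoc_castSucc, finRotate_apply, Fin.coeSucc_eq_succ, Fin.cons_succ]

lemma card_invariant_functions {n : ℕ} (N : ℕ) (ρ : Equiv.Perm (Fin n)) :
    Fintype.card {i : Fin n → Fin N // ∀ k, i (ρ k) = i k} = N ^ numCycles ρ := by
  classical
  have : Fintype (Quotient (Equiv.Perm.SameCycle.setoid ρ)) := Fintype.ofFinite _
  have e : {i : Fin n → Fin N // ∀ k, i (ρ k) = i k} ≃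
      (Quotient (Equiv.Perm.SameCycle.setoid ρ) → Fin N) :=
    { toFun := fun i => Quotient.lift i.1 fun x y (hxy : ρ.SameCycle x y) =>
        hxy.induction_closed (P := fun y => i.1 x = i.1 y)
          (fun z hz => hz.trans (i.2 z).symm) rfl
      invFun := fun f => ⟨fun k => f (Quotient.mk _ k), fun k => congrArg f
        (Quotient.sound (show ρ.SameCycle (ρ k) k by rw [Equiv.Perm.sameCycle_apply_left]))⟩
      left_inv := fun i => rfl
      right_inv := fun f => by ext q; induction q using Quotient.inductionOn; rfl }
  rw [Fintype.card_congr e, Fintype.card_fun, Fintype.card_fin, numCycles,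
    Nat.card_eq_fintype_card]

end Trace

/-! ### Moments of GUE matrices -/

section Moments

variable {Ω : Type*} [MeasurableSpace Ω] {N : ℕ} {P : Measure Ω}

lemma memLp_hermitianPart (i j : Fin N) (p : ℝ≥0) :
    MemLp (fun z => hermitianPart z i j) p (ginibreParts N) := by
  have hcoord : ∀ i j : Fin N, MeasurePreserving (fun z : Fin N → Fin N → ℝ × ℝ => z i j)
      (ginibreParts N)
      ((gaussianReal 0 (N : ℝ≥0)⁻¹).prod (gaussianReal 0 (N : ℝ≥0)⁻¹)) := fun i j =>
    (measurePreserving_eval (fun _ : Fin N => (gaussianReal 0 (N : ℝ≥0)⁻¹).prod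
      (gaussianReal 0 (N : ℝ≥0)⁻¹)) j).comp (measurePreserving_eval (fun _ : Fin N =>
      Measure.pi fun _ : Fin N => (gaussianReal 0 (N : ℝ≥0)⁻¹).prod
      (gaussianReal 0 (N : ℝ≥0)⁻¹)) i)
  have hg : MemLp (fun x : ℝ => (x : ℂ)) p (gaussianReal 0 (N : ℝ≥0)⁻¹) :=
    (memLp_id_gaussianReal p).ofReal
  have h1 : ∀ i j : Fin N, MemLp (fun z : Fin N → Fin N → ℝ × ℝ => ((z i j).1 : ℂ)) p
      (ginibreParts N) := fun i j =>
    hg.comp_measurePreserving (measurePreserving_fst.comp (hcoord i j))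
  have h2 : ∀ i j : Fin N, MemLp (fun z : Fin N → Fin N → ℝ × ℝ => ((z i j).2 : ℂ)) p
      (ginibreParts N) := fun i j =>
    hg.comp_measurePreserving (measurePreserving_snd.comp (hcoord i j))
  have h := ((((h1 i j).add ((h2 i j).const_mul Complex.I)).add
    ((h1 j i).sub ((h2 j i).const_mul Complex.I))).const_mul (1 / 2 : ℂ))
  refine (memLp_congr_ae (ae_of_all _ fun z => ?_)).1 h
  simp [hermitianPart, mul_comm]

lemma IsGUE.hasAllMoments {X : Ω → Matrix (Fin N) (Fin N) ℂ} (hX : IsGUE P X) :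
    HasAllMoments P X := by
  intro i j p
  have h1 : MemLp (fun x : Matrix (Fin N) (Fin N) ℂ => x i j) p (gueLaw N) := by
    rw [gueLaw_eq_map, memLp_map_measure_iff (measurable_entry i j).aestronglyMeasurable
      measurable_hermitianPart.aemeasurable]
    exact memLp_hermitianPart i j p
  have hX' : HasLaw X (gueLaw N) P := hX
  rw [← hX'.map_eq, memLp_map_measure_iff (measurable_entry i j).aestronglyMeasurable
      hX'.aemeasurable] at h1
  exact h1

/-- Expectations of functions of a GUE pair can be computed in the Gaussian coordinates. -/
lemma IsGUEPair.hasLaw [IsProbabilityMeasure P] {X : Fin 2 → Ω → Matrix (Fin N) (Fin N) ℂ}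
    (hX : IsGUEPair P X) :
    HasLaw (fun ω => (X 0 ω, X 1 ω)) (((ginibreParts N).prod (ginibreParts N)).map
      (Prod.map hermitianPart hermitianPart)) P := by
  have h := (indepFun_iff_hasLaw_prodMk_prod (hX.1 0) (hX.1 1)).1 hX.2
  rw [← Measure.map_prod_map _ _ measurable_hermitianPart measurable_hermitianPart,
    ← gueLaw_eq_map]
  exact h

/-- The Wick formula for the entries of a GUE pair. -/
lemma IsGUEPair.integral_prod_entry [IsProbabilityMeasure P] (hN : 1 ≤ N)
    {X : Fin 2 → Ω → Matrix (Fin N) (Fin N) ℂ} (hX : IsGUEPair P X) {n : ℕ} (e : Fin n → Fin 2)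
    (i j : Fin n → Fin N) :
    Integrable (fun ω => ∏ k, X (e k) ω (i k) (j k)) P ∧
    ∫ ω, ∏ k, X (e k) ω (i k) (j k) ∂P = ∑ π ∈ matchings Finset.univ,
      ∏ k, if e k = e (π k) ∧ i k = j (π k) ∧ j k = i (π k) then ((√N : ℝ) : ℂ)⁻¹ else 0 := by
  set F : Matrix (Fin N) (Fin N) ℂ × Matrix (Fin N) (Fin N) ℂ → ℂ :=
    fun x => ∏ k, ![x.1, x.2] (e k) (i k) (j k) with hF
  have hFm : Measurable F := by
    refine Finset.measurable_fun_prod _ fun k _ => ?_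
    have hc : ∀ c : Fin 2, Measurable fun x : Matrix (Fin N) (Fin N) ℂ × Matrix (Fin N) (Fin N) ℂ
        => ![x.1, x.2] c (i k) (j k) := by
      intro c
      fin_cases c
      · exact (measurable_entry _ _).comp measurable_fst
      · exact (measurable_entry _ _).comp measurable_snd
    exact hc _
  have hFX : (fun ω => ∏ k, X (e k) ω (i k) (j k)) = F ∘ fun ω => (X 0 ω, X 1 ω) := by
    ext ω
    refine Finset.prod_congr rfl fun k _ => ?_
    have hc : ∀ c : Fin 2, X c ω = ![X 0 ω, X 1 ω] c := by intro c; fin_cases c <;> rfl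
    rw [hc]
  have hΦ : Measurable (Prod.map (hermitianPart (N := N)) (hermitianPart (N := N))) :=
    measurable_hermitianPart.prodMap measurable_hermitianPart
  have hFΦ : ∀ z, F (Prod.map hermitianPart hermitianPart z) =
      MvPolynomial.eval (fun t => (partCoord N t z : ℂ))
        (∏ k, linearForm (entryCoeff (e k) (i k) (j k))) := by
    intro z
    rw [map_prod]
    refine Finset.prod_congr rfl fun k _ => ?_
    rw [eval_entryCoeff]
    rfl
  have hmom := hasGaussianMoments_partCoord N
  have hv : (N : ℝ≥0)⁻¹ ≠ 0 := inv_ne_zero (by exact_mod_cast (by omega : N ≠ 0))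
  have hlaw := hX.hasLaw
  constructor
  · rw [hFX, ← integrable_map_measure (by rw [hlaw.map_eq]; exact hFm.aestronglyMeasurable)
      hlaw.aemeasurable, hlaw.map_eq,
      integrable_map_measure hFm.aestronglyMeasurable hΦ.aemeasurable]
    exact (hmom.integrable_eval _).congr (ae_of_all _ fun z => (hFΦ z).symm)
  · rw [hFX, hlaw.integral_comp hFm.aestronglyMeasurable,
      integral_map hΦ.aemeasurable hFm.aestronglyMeasurable]
    simp only [hFΦ]
    refine hmom.wick hv (fun k => entryCoeff (e k) (i k) (j k))
      (fun k l => if e k = e l ∧ i k = j l ∧ j k = i l then ((√N : ℝ) : ℂ)⁻¹ else 0) ?_ _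
    intro k l
    rw [sum_entryCoeff_mul]
    have hsymm : (e l = e k ∧ i l = j k ∧ j l = i k) ↔ (e k = e l ∧ i k = j l ∧ j k = i l) := by
      constructor <;> rintro ⟨h1, h2, h3⟩ <;> exact ⟨h1.symm, h3.symm, h2.symm⟩
    simp only [hsymm]
    split_ifs
    · rw [← mul_inv, ← Complex.ofReal_mul, Real.mul_self_sqrt (Nat.cast_nonneg N)]
      simp
    · simp

lemma ofFn_prod_pi_apply {Ω M : Type*} [Monoid M] {n : ℕ} (Y : Fin n → Ω → M) (ω : Ω) :
    (List.ofFn Y).prod ω = (List.ofFn fun k => Y k ω).prod := by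
  rw [Pi.list_prod_apply, List.map_ofFn]
  rfl

lemma integrable_trace_word [IsProbabilityMeasure P]
    {X : Fin 2 → Ω → Matrix (Fin N) (Fin N) ℂ} (hX : IsGUEPair P X) {n : ℕ} (e : Fin n → Fin 2) :
    Integrable (fun ω => ((List.ofFn fun k => X (e k)).prod ω).trace) P := by
  rcases Nat.eq_zero_or_pos n with rfl | hn
  · simp
  rcases Nat.eq_zero_or_pos N with rfl | hN
  · simp [Matrix.trace]
  simp only [ofFn_prod_pi_apply, trace_ofFn_prod hn]
  exact integrable_finsetSum _ fun i _ => (hX.integral_prod_entry hN e _ _).1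

/-- The genus expansion. In the sum over all index tuples, the pairing `π` contributes for the
tuples that are constant on the cycles of `γ π`. -/
lemma IsGUEPair.expTrace_word [IsProbabilityMeasure P] (hN : 1 ≤ N)
    {X : Fin 2 → Ω → Matrix (Fin N) (Fin N) ℂ} (hX : IsGUEPair P X) {n : ℕ} (hn : 1 ≤ n)
    (e : Fin n → Fin 2) :
    expTrace P (List.ofFn fun k => X (e k)).prod = (cycleSum N n (colouredPairings e) : ℂ) := by
  classical
  have hN' : (0 : ℝ) < N := by exact_mod_cast hN
  simp only [expTrace, ofFn_prod_pi_apply, trace_ofFn_prod hn]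
  rw [integral_div, integral_finsetSum _ fun i _ => (hX.integral_prod_entry hN e _ _).1]
  simp only [(hX.integral_prod_entry hN e _ _).2]
  rw [Finset.sum_comm]
  have hset : colouredPairings e =
      ((matchings (Finset.univ : Finset (Fin n))).filter fun π => ∀ k, e (π k) = e k :
        Finset (Equiv.Perm (Fin n))) := by
    ext π
    simp only [colouredPairings, pairings, Set.mem_ofPred_eq, Finset.coe_filter, mem_matchings,
      Finset.eq_univ_iff_forall, Equiv.Perm.mem_support, forall_and, Function.Involutive]
  rw [cycleSum, hset, finsum_mem_coe_finset, Finset.sum_filter, Complex.ofReal_sum,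
    Finset.sum_div]
  refine Finset.sum_congr rfl fun π hπ => ?_
  have hinv := (mem_matchings.1 hπ).1
  simp only [Fintype.prod_ite_zero, Finset.prod_const, Finset.card_univ, Fintype.card_fin]
  have hcond : ∀ i : Fin n → Fin N, (∀ k, e k = e (π k) ∧ i k = i (finRotate n (π k)) ∧
      i (finRotate n k) = i (π k)) ↔
      (∀ k, e (π k) = e k) ∧ ∀ k, i ((finRotate n * π) k) = i k := by
    intro i
    constructor
    · exact fun h => ⟨fun k => (h k).1.symm, fun k => (h k).2.1.symm⟩
    · rintro ⟨h1, h2⟩ k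
      refine ⟨(h1 k).symm, (h2 k).symm, ?_⟩
      have := h2 (π k)
      rwa [Equiv.Perm.mul_apply, hinv] at this
  simp only [hcond]
  split_ifs with he
  · simp only [he, implies_true, true_and]
    rw [← Finset.sum_filter, Finset.sum_const, ← Fintype.card_subtype, card_invariant_functions,
      nsmul_eq_mul]
    have : (N : ℝ) ^ ((numCycles (finRotate n * π) : ℝ) - 1 - (n : ℝ) / 2) =
        (N : ℝ) ^ numCycles (finRotate n * π) * (√N)⁻¹ ^ n / N := by
      rw [sub_right_comm, Real.rpow_sub_one hN'.ne', Real.rpow_sub hN', Real.rpow_natCast,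
        Real.rpow_div_two_eq_sqrt _ hN'.le, Real.rpow_natCast, inv_pow, ← div_eq_mul_inv]
    rw [this]
    push_cast
    rfl
  · simp [he]

end Moments

/-! ### Limits as the matrix size tends to infinity -/

lemma tendsto_cycleSum_term {n : ℕ} (hn : 1 ≤ n) {π : Equiv.Perm (Fin n)} (hπ : π ∈ pairings n)
    [Decidable (NonCrossing π)] :
    Tendsto (fun N : ℕ => (N : ℝ) ^ ((numCycles (finRotate n * π) : ℝ) - 1 - (n : ℝ) / 2)) atTop
      (𝓝 (if NonCrossing π then 1 else 0)) := by
  have hinv : Function.Involutive π := fun k => (hπ k).1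
  have hsupp : π.support.card = n := by
    have : π.support = Finset.univ := Finset.eq_univ_iff_forall.2 fun k =>
      Equiv.Perm.mem_support.2 (hπ k).2
    rw [this, Finset.card_univ, Fintype.card_fin]
  split_ifs with h
  · have h2 := h.numCycles_eq hn hinv
    rw [hsupp] at h2
    have h2' : 2 * (numCycles (finRotate n * π) : ℝ) = 2 + n := by exact_mod_cast h2
    have : (numCycles (finRotate n * π) : ℝ) - 1 - (n : ℝ) / 2 = 0 := by linarith
    simp [this]
  · have h2 := numCycles_lt_of_not_nonCrossing hn hinv h
    rw [hsupp] at h2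
    have h2' : 2 * (numCycles (finRotate n * π) : ℝ) < 2 + n := by exact_mod_cast h2
    have := (tendsto_rpow_neg_atTop (y := -((numCycles (finRotate n * π) : ℝ) - 1 - (n : ℝ) / 2))
      (by linarith)).comp tendsto_natCast_atTop_atTop
    simpa only [neg_neg, Function.comp_def] using this

lemma tendsto_cycleSum {n : ℕ} (hn : 1 ≤ n) {S : Set (Equiv.Perm (Fin n))}
    (hS : S ⊆ pairings n) :
    Tendsto (fun N : ℕ => cycleSum N n S) atTop (𝓝 ({π | π ∈ S ∧ NonCrossing π}.ncard : ℝ)) := by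
  classical
  obtain ⟨s, rfl⟩ : ∃ s : Finset (Equiv.Perm (Fin n)), S = s := ⟨S.toFinset, by simp⟩
  have h1 : {π | π ∈ (s : Set (Equiv.Perm (Fin n))) ∧ NonCrossing π} =
      (s.filter NonCrossing : Finset (Equiv.Perm (Fin n))) := by
    ext π; simp
  rw [h1, Set.ncard_coe_finset, Finset.card_filter]
  simp only [cycleSum, finsum_mem_coe_finset]
  push_cast
  exact tendsto_finsetSum _ fun π hπ => tendsto_cycleSum_term hn (hS hπ)

lemma lift_word {A : Type*} [Ring A] [Algebra ℂ A] (Y : Fin 2 → A) {n : ℕ} (e : Fin n → Fin 2) :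
    FreeAlgebra.lift ℂ Y ((List.ofFn e).map (FreeAlgebra.ι ℂ)).prod =
      (List.ofFn fun k => Y (e k)).prod := by
  rw [map_list_prod, List.map_map, List.map_ofFn]
  congr 2
  ext k
  simp

section Pair

variable {Ω : ℕ → Type*} [∀ N, MeasurableSpace (Ω N)] {P : ∀ N, Measure (Ω N)}
  [∀ N, IsProbabilityMeasure (P N)] {X : ∀ N, Fin 2 → Ω N → Matrix (Fin N) (Fin N) ℂ}

lemma tendsto_expTrace_word (hX : ∀ N, IsGUEPair (P N) (X N)) (n : ℕ) (e : Fin n → Fin 2) :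
    Tendsto (fun N => expTrace (P N) (List.ofFn fun k => X N (e k)).prod) atTop
      (𝓝 ((nonCrossingColouredPairings e).ncard : ℂ)) := by
  rcases Nat.eq_zero_or_pos n with rfl | hn
  · have h1 : ((nonCrossingColouredPairings e).ncard : ℂ) = 1 := by
      rw [← prod_fockOp_vacuum_eq_ncard]; simp [vacuum]
    rw [h1]
    refine tendsto_const_nhds.congr' ?_
    filter_upwards [eventually_ge_atTop 1] with N hN
    have : (N : ℂ) ≠ 0 := by exact_mod_cast (by omega : N ≠ 0)
    simp [expTrace, Matrix.trace_one, this]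
  · have h := tendsto_cycleSum hn (S := colouredPairings e) (fun π hπ => hπ.1)
    refine ((Complex.continuous_ofReal.tendsto _).comp h).congr' ?_
    filter_upwards [eventually_ge_atTop 1] with N hN
    exact ((hX N).expTrace_word hN hn e).symm

/-- The limit distribution of a GUE pair is that of the semicircular operators on the full Fock
space, with respect to the vacuum state. -/
lemma tendsto_expTrace_lift (hX : ∀ N, IsGUEPair (P N) (X N)) (q : FreeAlgebra ℂ (Fin 2)) :
    (∀ N, Integrable (fun ω => (FreeAlgebra.lift ℂ (X N) q ω).trace) (P N)) ∧
    Tendsto (fun N => expTrace (P N) (FreeAlgebra.lift ℂ (X N) q)) atTop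
      (𝓝 (FreeAlgebra.lift ℂ fockOp q vacuum [])) := by
  have hq : q ∈ Submodule.span ℂ
      (Submonoid.closure (Set.range (FreeAlgebra.ι ℂ : Fin 2 → _)) : Set _) := by
    have h : q ∈ Algebra.adjoin ℂ (Set.range (FreeAlgebra.ι ℂ : Fin 2 → _)) := by
      rw [FreeAlgebra.adjoin_range_ι]
      exact Algebra.mem_top
    rwa [← Subalgebra.mem_toSubmodule, Algebra.adjoin_eq_span] at h
  induction hq using Submodule.span_induction with
  | mem x hx =>
    obtain ⟨l, hl, rfl⟩ := Submonoid.exists_list_of_mem_closure hx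
    obtain ⟨l, rfl⟩ : ∃ l' : List (Fin 2), l'.map (FreeAlgebra.ι ℂ) = l := by
      have : l ∈ Set.range (List.map (FreeAlgebra.ι ℂ : Fin 2 → _)) := by
        rw [Set.range_list_map]; exact hl
      exact this
    obtain ⟨n, e, rfl⟩ : ∃ n, ∃ e : Fin n → Fin 2, l = List.ofFn e :=
      ⟨l.length, l.get, (List.ofFn_get l).symm⟩
    have hlim : FreeAlgebra.lift ℂ fockOp ((List.ofFn e).map (FreeAlgebra.ι ℂ)).prod =
        ((List.ofFn e).map fockOp).prod := by
      rw [lift_word, List.map_ofFn]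
      rfl
    rw [hlim, prod_fockOp_vacuum_eq_ncard]
    simp only [lift_word]
    exact ⟨fun N => integrable_trace_word (hX N) e, tendsto_expTrace_word hX n e⟩
  | zero => simp [expTrace]
  | add x y _ _ hx hy =>
    refine ⟨fun N => ?_, ?_⟩
    · simp only [map_add, Pi.add_apply, Matrix.trace_add]
      exact (hx.1 N).add (hy.1 N)
    · simp only [map_add, LinearMap.add_apply, Pi.add_apply]
      refine (hx.2.add hy.2).congr fun N => ?_
      simp only [expTrace, Pi.add_apply, Matrix.trace_add, add_div]
      exact (integral_add ((hx.1 N).div_const _) ((hy.1 N).div_const _)).symm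
  | smul c x _ hx =>
    refine ⟨fun N => ?_, ?_⟩
    · simpa [Matrix.trace_smul] using (hx.1 N).const_mul c
    · simp only [map_smul, LinearMap.smul_apply, Pi.smul_apply, smul_eq_mul]
      refine (hx.2.const_mul c).congr fun N => ?_
      simp only [expTrace, Pi.smul_apply, Matrix.trace_smul, smul_eq_mul, mul_div_assoc]
      exact (integral_const_mul c _).symm

lemma lift_aeval_ι {A : Type*} [Ring A] [Algebra ℂ A] (Y : Fin 2 → A) (a : Fin 2)
    (f : Polynomial ℂ) :
    FreeAlgebra.lift ℂ Y (Polynomial.aeval (FreeAlgebra.ι ℂ a) f) = Polynomial.aeval (Y a) f := by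
  rw [← Polynomial.aeval_algHom_apply, FreeAlgebra.lift_ι_apply]

lemma asymptoticallyFree_of_isGUEPair (hX : ∀ N, IsGUEPair (P N) (X N)) :
    AsymptoticallyFree (fun N => expTrace (P N)) X := by
  intro w hw hchain hcent
  have h0 : ∀ a ∈ w, Polynomial.aeval (fockOp a.1) a.2 vacuum [] = 0 := by
    intro a ha
    have h := (tendsto_expTrace_lift hX (Polynomial.aeval (FreeAlgebra.ι ℂ a.1) a.2)).2
    simp only [lift_aeval_ι] at h
    exact tendsto_nhds_unique h (hcent a ha)
  have h := (tendsto_expTrace_lift hX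
    (w.map fun a => Polynomial.aeval (FreeAlgebra.ι ℂ a.1) a.2).prod).2
  simp only [map_list_prod, List.map_map, Function.comp_def, lift_aeval_ι] at h
  obtain ⟨a, w, rfl⟩ := List.exists_cons_of_ne_nil hw
  rwa [alternating_prod_vacuum _ hchain h0 a rfl [] (by simp)] at h

lemma pow_eq_ofFn_prod {A : Type*} [Monoid A] (x : A) (n : ℕ) :
    x ^ n = (List.ofFn fun _ : Fin n => x).prod := by
  rw [List.ofFn_const, List.prod_replicate]

lemma asymptoticallySemicircular_of_isGUEPair (hX : ∀ N, IsGUEPair (P N) (X N)) (i : Fin 2) :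
    AsymptoticallySemicircular (fun N => expTrace (P N)) (fun N => X N i) := by
  intro n
  have h := tendsto_expTrace_word hX n (fun _ => i)
  rw [← prod_fockOp_vacuum_eq_ncard, List.ofFn_const, List.map_replicate, List.prod_replicate,
    fockOp_pow_vacuum] at h
  simpa only [pow_eq_ofFn_prod] using h

end Pair

/-! ### Adjoining an independent copy -/

section Copy

lemma measurable_trace_pow (N n : ℕ) :
    Measurable fun x : Matrix (Fin N) (Fin N) ℂ => (x ^ n).trace / (N : ℂ) := by
  have h : ∀ i j, Measurable fun x : Matrix (Fin N) (Fin N) ℂ => (x ^ n) i j := by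
    induction n with
    | zero => simp
    | succ n ih =>
      intro i j
      simp only [pow_succ, Matrix.mul_apply]
      exact Finset.measurable_fun_sum _ fun k _ => (ih i k).mul (measurable_entry k j)
  exact (Finset.measurable_fun_sum _ fun i _ => h i i).div_const _

lemma IsGUE.expTrace_pow {Ω : Type*} [MeasurableSpace Ω] {N : ℕ} {P : Measure Ω}
    {X : Ω → Matrix (Fin N) (Fin N) ℂ} (hX : IsGUE P X) (n : ℕ) :
    expTrace P (X ^ n) = ∫ x, (x ^ n).trace / (N : ℂ) ∂gueLaw N :=
  HasLaw.integral_comp hX (measurable_trace_pow N n).aestronglyMeasurable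

/-- The canonical pair of independent GUE matrices. -/
def guePair (N : ℕ) (c : Fin 2) (x : Matrix (Fin N) (Fin N) ℂ × Matrix (Fin N) (Fin N) ℂ) :
    Matrix (Fin N) (Fin N) ℂ := ![x.1, x.2] c

lemma isGUEPair_guePair (N : ℕ) : IsGUEPair ((gueLaw N).prod (gueLaw N)) (guePair N) := by
  have h0 : IsGUE ((gueLaw N).prod (gueLaw N)) (guePair N 0) := measurePreserving_fst.hasLaw
  have h1 : IsGUE ((gueLaw N).prod (gueLaw N)) (guePair N 1) := measurePreserving_snd.hasLaw
  refine ⟨fun i => by fin_cases i; exacts [h0, h1], ?_⟩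
  exact (indepFun_iff_hasLaw_prodMk_prod h0 h1).2 HasLaw.id

lemma IsGUE.expTrace_pow_eq_guePair {Ω : Type*} [MeasurableSpace Ω] {N : ℕ} {P : Measure Ω}
    {X : Ω → Matrix (Fin N) (Fin N) ℂ} (hX : IsGUE P X) (n : ℕ) :
    expTrace P (X ^ n) = expTrace ((gueLaw N).prod (gueLaw N)) (guePair N 0 ^ n) := by
  rw [hX.expTrace_pow, ((isGUEPair_guePair N).1 0).expTrace_pow]

end Copy

end

theorem mainTheorem1 {Ω : ℕ → Type*} [∀ N, MeasurableSpace (Ω N)]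
    (P : ∀ N, Measure (Ω N)) [∀ N, IsProbabilityMeasure (P N)] :
    -- one GUE matrix
    (∀ X : ∀ N, Ω N → Matrix (Fin N) (Fin N) ℂ, (∀ N, IsGUE (P N) (X N)) →
      (∀ N, HasAllMoments (P N) (X N)) ∧
      (∀ N n : ℕ, 1 ≤ N → 1 ≤ n →
        expTrace (P N) (X N ^ n) = (cycleSum N n (pairings n) : ℂ)) ∧
      AsymptoticallySemicircular (fun N => expTrace (P N)) X) ∧
    -- two independent GUE matrices
    (∀ X : ∀ N, Fin 2 → Ω N → Matrix (Fin N) (Fin N) ℂ, (∀ N, IsGUEPair (P N) (X N)) →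
      (∀ N i, HasAllMoments (P N) (X N i)) ∧
      (∀ N n : ℕ, 1 ≤ N → 1 ≤ n → ∀ e : Fin n → Fin 2,
        expTrace (P N) (List.ofFn fun k => X N (e k)).prod =
          (cycleSum N n (colouredPairings e) : ℂ)) ∧
      (∀ (n : ℕ) (e : Fin n → Fin 2),
        Tendsto (fun N => expTrace (P N) (List.ofFn fun k => X N (e k)).prod) atTop
          (𝓝 ((nonCrossingColouredPairings e).ncard : ℂ))) ∧
      (∀ i, AsymptoticallySemicircular (fun N => expTrace (P N)) (fun N => X N i)) ∧
      AsymptoticallyFree (fun N => expTrace (P N)) X) := by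
  refine ⟨fun X hX => ⟨fun N => (hX N).hasAllMoments, fun N n hN hn => ?_, fun n => ?_⟩,
    fun X hX => ⟨fun N i => ((hX N).1 i).hasAllMoments,
      fun N n hN hn e => (hX N).expTrace_word hN hn e, tendsto_expTrace_word hX,
      asymptoticallySemicircular_of_isGUEPair hX, asymptoticallyFree_of_isGUEPair hX⟩⟩
  · have hset : colouredPairings (fun _ : Fin n => (0 : Fin 2)) = pairings n := by
      ext π; simp [colouredPairings]
    rw [(hX N).expTrace_pow_eq_guePair, pow_eq_ofFn_prod,
      (isGUEPair_guePair N).expTrace_word hN hn fun _ => 0, hset]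
  · simp only [(hX _).expTrace_pow_eq_guePair]
    exact asymptoticallySemicircular_of_isGUEPair isGUEPair_guePair 0 n
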